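/- A Bayesian principal-agent instance with $\ell$ types, $n$ actions and $m$ outcomes consists of a distribution $\mu$ on the types, for every type $\theta$ and action $a$ a distribution $F_{\theta,a}$ on the outcomes and a cost $c_{\theta,a}\in[0,1]$, and for every outcome $\omega$ a reward $r_\omega\in[0,1]$, all numbers being rational; some action $a$ satisfies $c_{\theta,a}=0$ for all $\theta$. Under a contract $p\in\mathbb{R}_{\ge 0}^m$, type $\theta$ plays an action $b^\theta(p)$ that maximizes $U^\theta(a,p)=\sum_\omega F_{\theta,a,\omega}\,p_\omega-c_{\theta,a}$ over all actions $a$ and, among these maximizers, maximizes the principal's utility $V^\theta(a,p)=\sum_\omega F_{\theta,a,\omega}\,r_\omega-\sum_\omega F_{\theta,a,\omega}\,p_\omega$. A menu of deterministic contracts $P=(p^\theta)_\theta$ assigns to every type $\theta$ a contract $p^\theta\in\mathbb{R}_{\ge 0}^m$; it is DSIC (dominant-strategy incentive compatible) if $U^\theta(b^\theta(p^\theta),p^\theta)\ge U^\theta(b^\theta(p^{\hat\theta}),p^{\hat\theta})$ for all types $\theta\ne\hat\theta$. Its value is $\sum_\theta\mu_\theta V^\theta(b^\theta(p^\theta),p^\theta)$.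 Theorem. There exists an additive PTAS for the problem of computing an optimal DSIC menu of deterministic contracts in Bayesian principal-agent instances with a constant number of outcomes. That is, there is an algorithm that takes as input a rational $\delta>0$ and an instance, and outputs a DSIC menu of deterministic contracts (with rational payments) whose value is at least the value of every DSIC menu of deterministic contracts minus $\delta$; and for every fixed $\delta$ and every fixed number $m$ of outcomes, its running time on instances with $m$ outcomes is bounded by a polynomial in the bit size of the instance. (The running time is the logarithmic cost of a while-program over binary trees with integer leaves, in which every operation is charged the bit size of the data it reads and writes; this is polynomially related to Turing machine time.) -/

import Mathlib

/-! ### Bayesian principal-agent instances and menus of deterministic contracts -/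

/-- A Bayesian principal-agent instance with `ℓ` types, `n` actions and `m` outcomes.  The data
are rational, so that an instance is a finite input for an algorithm. -/
structure PAInstance (ℓ n m : ℕ) where
  /-- the distribution of the agent's type -/
  μ : Fin ℓ → ℚ
  /-- `F θ a ω` is the probability of outcome `ω` when type `θ` plays `a` -/
  F : Fin ℓ → Fin n → Fin m → ℚ
  /-- `c θ a` is the cost of action `a` for type `θ` -/
  c : Fin ℓ → Fin n → ℚ
  /-- the principal's rewards -/
  r : Fin m → ℚ
  μ_nonneg : ∀ θ, 0 ≤ μ θ
  μ_sum : ∑ θ, μ θ = 1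
  F_nonneg : ∀ θ a ω, 0 ≤ F θ a ω
  F_sum : ∀ θ a, ∑ ω, F θ a ω = 1
  c_nonneg : ∀ θ a, 0 ≤ c θ a
  c_le_one : ∀ θ a, c θ a ≤ 1
  r_nonneg : ∀ ω, 0 ≤ r ω
  r_le_one : ∀ ω, r ω ≤ 1
  /-- some action is free for every type (this makes every best response individually rational) -/
  exists_free : ∃ a, ∀ θ, c θ a = 0

namespace PAInstance

variable {ℓ n m : ℕ} (I : PAInstance ℓ n m)

/-- Expected utility of type `θ` playing action `a` under contract `p`. -/
noncomputable def agentUtility (θ : Fin ℓ) (a : Fin n) (p : Fin m → ℝ) : ℝ :=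
  ∑ ω, (I.F θ a ω : ℝ) * p ω - (I.c θ a : ℝ)

/-- Expected utility of the principal when type `θ` plays action `a` under contract `p`. -/
noncomputable def principalUtility (θ : Fin ℓ) (a : Fin n) (p : Fin m → ℝ) : ℝ :=
  ∑ ω, (I.F θ a ω : ℝ) * (I.r ω : ℝ) - ∑ ω, (I.F θ a ω : ℝ) * p ω

/-- The set of best responses of type `θ` under contract `p`. -/
def bestResponses (θ : Fin ℓ) (p : Fin m → ℝ) : Set (Fin n) :=
  {a | ∀ a', I.agentUtility θ a' p ≤ I.agentUtility θ a p}

theorem exists_bestResponse (θ : Fin ℓ) (p : Fin m → ℝ) :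
    ∃ a ∈ I.bestResponses θ p, ∀ a' ∈ I.bestResponses θ p,
      I.principalUtility θ a' p ≤ I.principalUtility θ a p := by
  obtain ⟨a₀, -⟩ := I.exists_free
  have : Nonempty (Fin n) := ⟨a₀⟩
  obtain ⟨a₁, h₁⟩ := Finite.exists_max (fun a => I.agentUtility θ a p)
  exact Set.exists_max_image _ _ (Set.toFinite _) ⟨a₁, h₁⟩

/-- The best response `b^θ(p)` that is played: ties are broken in favour of the principal. -/
noncomputable def bestResponse (θ : Fin ℓ) (p : Fin m → ℝ) : Fin n :=
  (I.exists_bestResponse θ p).choose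

/-- `P` is a menu of deterministic contracts (one vector of non-negative payments for each type)
that is dominant-strategy incentive compatible. -/
def IsDSIC (P : Fin ℓ → Fin m → ℝ) : Prop :=
  (∀ θ ω, 0 ≤ P θ ω) ∧
  ∀ θ θ' : Fin ℓ, θ' ≠ θ →
    I.agentUtility θ (I.bestResponse θ (P θ')) (P θ') ≤
      I.agentUtility θ (I.bestResponse θ (P θ)) (P θ)

/-- The principal's expected utility in a menu when every type reports truthfully. -/
noncomputable def menuUtility (P : Fin ℓ → Fin m → ℝ) : ℝ :=
  ∑ θ, (I.μ θ : ℝ) * I.principalUtility θ (I.bestResponse θ (P θ)) (P θ)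

end PAInstance

/-! ### A model of computation with logarithmic cost -/

/-- The data of the machine model: binary trees with integers at the leaves. -/
inductive Data where
  | int (z : ℤ)
  | pair (x y : Data)

namespace Data

/-- The size of a datum in bits: integers count with their binary length, every node counts one. -/
def size : Data → ℕ
  | int z => Nat.size z.natAbs + 1
  | pair x y => size x + size y + 1

/-- Lists as right-nested pairs that end in the integer `0`. -/
def ofList : List Data → Data
  | [] => int 0
  | x :: l => pair x (ofList l)

/-- A finite tuple as a list. -/
def ofTuple {k : ℕ} (f : Fin k → Data) : Data :=
  ofList (List.ofFn f)

/-- A rational number as numerator and denominator in lowest terms. -/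
def ofRat (q : ℚ) : Data :=
  pair (int q.num) (int q.den)

end Data

/-- Primitive operations on data. -/
inductive PrimOp where
  | id
  | const (z : ℤ)
  | fst
  | snd
  | isPair
  | add
  | sub
  | mul
  | div
  | le

/-- The result of a primitive operation (the integer `0` on arguments of the wrong shape). -/
def PrimOp.eval : PrimOp → Data → Data
  | .id, x => x
  | .const z, _ => .int z
  | .fst, .pair x _ => x
  | .snd, .pair _ y => y
  | .isPair, .pair _ _ => .int 1
  | .add, .pair (.int a) (.int b) => .int (a + b)
  | .sub, .pair (.int a) (.int b) => .int (a - b)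
  | .mul, .pair (.int a) (.int b) => .int (a * b)
  | .div, .pair (.int a) (.int b) => .int (a / b)
  | .le, .pair (.int a) (.int b) => if a ≤ b then .int 1 else .int 0
  | _, _ => .int 0

/-- Programs: primitive operations, composition (`comp g f` runs `f` first), pairing of two results,
branching, and while loops.  A test succeeds if its result is not the integer `0`. -/
inductive Program where
  | prim (o : PrimOp)
  | comp (g f : Program)
  | pair (f g : Program)
  | ite (c f g : Program)
  | loop (c f : Program)

/-- `Program.Run p x y t`: on input `x` the program `p` halts with output `y`, at cost `t`.
A primitive operation is charged the bit sizes of its argument and of its result, and every copy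
that is made of the current datum is charged its bit size, so that this is a logarithmic cost
measure, polynomially related to the running time of multitape Turing machines. -/
inductive Program.Run : Program → Data → Data → ℕ → Prop where
  | prim (o : PrimOp) (x : Data) : Run (.prim o) x (o.eval x) (x.size + (o.eval x).size)
  | comp {g f : Program} {x y z : Data} {s t : ℕ} :
      Run f x y s → Run g y z t → Run (.comp g f) x z (s + t + 1)
  | pair {f g : Program} {x y z : Data} {s t : ℕ} :
      Run f x y s → Run g x z t → Run (.pair f g) x (.pair y z) (s + t + x.size + 1)
  | ite_true {c f g : Program} {x v y : Data} {s t : ℕ} :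
      Run c x v s → v ≠ .int 0 → Run f x y t → Run (.ite c f g) x y (s + t + x.size)
  | ite_false {c f g : Program} {x y : Data} {s t : ℕ} :
      Run c x (.int 0) s → Run g x y t → Run (.ite c f g) x y (s + t + x.size)
  | loop_stop {c f : Program} {x : Data} {s : ℕ} :
      Run c x (.int 0) s → Run (.loop c f) x x (s + x.size)
  | loop_step {c f : Program} {x v y z : Data} {s t u : ℕ} :
      Run c x v s → v ≠ .int 0 → Run f x y t → Run (.loop c f) y z u →
        Run (.loop c f) x z (s + t + u + x.size)

/-! ### Additive polynomial-time approximation schemes -/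

/-- An instance as a datum: the lists of the `μ θ`, the `F θ a ω`, the `c θ a` and the `r ω`. -/
def PAInstance.toData {ℓ n m : ℕ} (I : PAInstance ℓ n m) : Data :=
  .pair (Data.ofTuple fun θ => Data.ofRat (I.μ θ))
    (.pair (Data.ofTuple fun θ => Data.ofTuple fun a => Data.ofTuple fun ω => Data.ofRat (I.F θ a ω))
      (.pair (Data.ofTuple fun θ => Data.ofTuple fun a => Data.ofRat (I.c θ a))
        (Data.ofTuple fun ω => Data.ofRat (I.r ω))))

/-- The datum `d` represents the menu `P`: it is the list over the types of the lists over the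
outcomes of the payments, written as fractions with positive denominator. -/
def RepresentsMenu {ℓ m : ℕ} (d : Data) (P : Fin ℓ → Fin m → ℝ) : Prop :=
  ∃ num den : Fin ℓ → Fin m → ℤ,
    (∀ θ ω, 0 < den θ ω ∧ P θ ω = (num θ ω : ℝ) / (den θ ω : ℝ)) ∧
    d = Data.ofTuple fun θ => Data.ofTuple fun ω => .pair (.int (num θ ω)) (.int (den θ ω))

/-- `A` is an additive PTAS for computing an optimal DSIC menu of deterministic contracts in
instances with `m` outcomes: given `δ > 0` and an instance, it outputs a DSIC menu whose utility is
within `δ` of that of every DSIC menu, and for every fixed `δ` its running time is bounded by a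
polynomial in the size of the instance. -/
def IsAdditivePTAS (m : ℕ) (A : Program) : Prop :=
  ∀ δ : ℚ, 0 < δ → ∃ q : Polynomial ℕ, ∀ (ℓ n : ℕ) (I : PAInstance ℓ n m),
    ∃ (out : Data) (t : ℕ) (P : Fin ℓ → Fin m → ℝ),
      A.Run (.pair (Data.ofRat δ) I.toData) out t ∧
      t ≤ q.eval I.toData.size ∧
      RepresentsMenu out P ∧
      I.IsDSIC P ∧
      ∀ P' : Fin ℓ → Fin m → ℝ, I.IsDSIC P' → I.menuUtility P' - (δ : ℝ) ≤ I.menuUtility P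

/-! ### Polynomial-time functions on encoded data -/

/-! Only boundedly many contracts need to be offered, and they can be drawn from a list of
polynomial length; exhaustive search then suffices.

Let `D` be a common denominator of the instance, `A` twice the denominator of `δ`, and `N =
A²(4m+1)`. Take a DSIC menu `P` of nonnegative value, with agent utilities `u θ`. Since welfare is
at most one, `∑ μ θ * u θ ≤ 1`. If `M ω` is the largest payment for `ω`, type `θ` could report the
type receiving it, so `F θ a ω * M ω ≤ u θ + 1`. Hence `M ω ≤ 2D²` whenever `ω` can occur, and some
iterated half `g ω` of `2D²` satisfies `M ω ≤ g ω ≤ 2 * M ω + 1`. Rounding payments down to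
multiples of `g ω / N` leaves at most `(N+1)^m` contracts and changes expected payments by at most
`η θ = (2m(u θ + 1) + 1)/N`, whose mean over the types is at most `(4m+1)/N`.

Rounding may upset incentives, so each rounded contract is replaced by `(1 - 1/A)` times itself plus
`1/A` times the rewards. A deviation then gains the agent at most a multiple of `η θ` from rounding,
while the reward share penalizes harm to the principal; thus whatever favourite pair of contract and
action is chosen, the principal loses at most `A * η θ` before the factor `1 - 1/A`. The total loss
is at most `1/A + A(4m+1)/N = 2/A ≤ δ` (`IsDSIC.exists_rounding`).

The algorithm tries all lists of `(N+1)^m` contracts from the discretized ones, lets every type pick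
a favourite, and keeps the best outcome. Self-selection gives DSIC, and the principal's tie-breaking
can only improve the computed value (`solve_spec`). For fixed `m` and `δ` the exponents are constant
and the number of scales `g` is linear in the bit size of `D` (`PolyOn.menus`). Running times are
handled by a calculus of polynomial-time functions, `PolyOn`: one program serves all parameters `k`,
only its polynomial depends on `k`. -/

theorem Program.Run.size_le {p : Program} {x y : Data} {t : ℕ} (h : p.Run x y t) : y.size ≤ t := by
  induction h <;> (try simp only [Data.size]) <;> omega

theorem Polynomial.eval_mono_nat (q : Polynomial ℕ) {a b : ℕ} (h : a ≤ b) :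
    q.eval a ≤ q.eval b := by
  rw [Polynomial.eval_eq_sum_range, Polynomial.eval_eq_sum_range]
  gcongr

/-- Types whose elements are represented by data of the machine model. -/
class Enc (α : Type) where
  /-- the representation of an element -/
  enc : α → Data

open Enc in
/-- The bit size of the representation of `x`. -/
def sz {α : Type} [Enc α] (x : α) : ℕ := (enc x).size

instance : Enc ℤ := ⟨Data.int⟩
instance : Enc ℚ := ⟨Data.ofRat⟩
instance : Enc Bool := ⟨fun b => Data.int (if b then 1 else 0)⟩
instance {α β : Type} [Enc α] [Enc β] : Enc (α × β) := ⟨fun x => .pair (Enc.enc x.1) (Enc.enc x.2)⟩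
instance {α : Type} [Enc α] : Enc (List α) := ⟨fun l => Data.ofList (l.map Enc.enc)⟩

theorem Data.one_le_size (d : Data) : 1 ≤ d.size := by cases d <;> simp [Data.size]

/-! ### Bit sizes of encoded data -/

section Size

variable {α β : Type} [Enc α] [Enc β]

theorem one_le_sz (x : α) : 1 ≤ sz x := Data.one_le_size _

theorem sz_pair (x : α) (y : β) : sz (x, y) = sz x + sz y + 1 := rfl

theorem sz_nil : sz ([] : List α) = 1 := rfl

theorem sz_cons (x : α) (l : List α) : sz (x :: l) = sz x + sz l + 1 := rfl

theorem sz_int (z : ℤ) : sz z = Nat.size z.natAbs + 1 := rfl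

theorem sz_append (l l' : List α) : sz (l ++ l') + 1 = sz l + sz l' := by
  induction l with
  | nil => simp [sz_nil, add_comm]
  | cons x l ih => simp only [List.cons_append, sz_cons]; omega

theorem sz_le_of_mem {x : α} {l : List α} (h : x ∈ l) : sz x ≤ sz l := by
  induction l with
  | nil => simp at h
  | cons y l ih =>
    rw [sz_cons]
    rcases List.mem_cons.1 h with rfl | h
    · omega
    · have := ih h; omega

theorem length_le_sz (l : List α) : l.length ≤ sz l := by
  induction l with
  | nil => simp
  | cons y l ih => rw [sz_cons, List.length_cons]; omega

theorem sz_drop_le (l : List α) (i : ℕ) : sz (l.drop i) ≤ sz l := by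
  have := sz_append (l.take i) (l.drop i)
  rw [List.take_append_drop] at this
  have := one_le_sz (l.take i)
  omega

theorem sz_add_le (a b : ℤ) : sz (a + b) ≤ sz a + sz b := by
  rw [sz_int, sz_int, sz_int]
  have h : (a + b).natAbs.size ≤ a.natAbs.size + b.natAbs.size := by
    rw [Nat.size_le]
    have h1 := Nat.lt_size_self a.natAbs
    have h2 := Nat.lt_size_self b.natAbs
    have h3 := Int.natAbs_add_le a b
    rw [pow_add]
    generalize 2 ^ a.natAbs.size = u at *
    generalize 2 ^ b.natAbs.size = v at *
    obtain ⟨i, rfl⟩ := Nat.exists_eq_add_of_lt h1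
    obtain ⟨j, rfl⟩ := Nat.exists_eq_add_of_lt h2
    -- With `u` and `v` the two powers of two, this is `(u - 1) * (v - 1) ≥ 0`, so `u * v ≥ u + v -
    -- 1 > |a| + |b|`.
    have := Nat.zero_le ((a.natAbs + i) * (b.natAbs + j))
    linarith
  omega

theorem sz_mul_le (a b : ℤ) : sz (a * b) ≤ sz a + sz b := by
  rw [sz_int, sz_int, sz_int]
  have h : (a * b).natAbs.size ≤ a.natAbs.size + b.natAbs.size := by
    rw [Nat.size_le, Int.natAbs_mul, pow_add]
    exact Nat.mul_lt_mul'' (Nat.lt_size_self _) (Nat.lt_size_self _)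
  omega

end Size

/-- The function `f` is computed by a program whose running time is bounded on every set `S k` by a
polynomial (which depends on `k`) in the size of the input. -/
def PolyOn {κ α β : Type} [Enc α] [Enc β] (S : κ → Set α) (f : α → β) : Prop :=
  ∃ p : Program, ∀ k, ∃ q : Polynomial ℕ, ∀ x ∈ S k, ∃ t ≤ q.eval (sz x),
    p.Run (Enc.enc x) (Enc.enc (f x)) t

/-- The family of sets of pairs whose first component lies in `S k`. -/
def extend {κ α β : Type} (S : κ → Set α) : κ → Set (α × β) := fun k => {y | y.1 ∈ S k}

namespace PolyOn

variable {κ ι α β γ δ : Type} [Enc α] [Enc β] [Enc γ] [Enc δ] {S : κ → Set α}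

theorem size_bound {f : α → β} (hf : PolyOn S f) (k : κ) :
    ∃ q : Polynomial ℕ, ∀ x ∈ S k, sz (f x) ≤ q.eval (sz x) := by
  obtain ⟨p, hp⟩ := hf
  obtain ⟨q, hq⟩ := hp k
  refine ⟨q, fun x hx => ?_⟩
  obtain ⟨t, ht, hr⟩ := hq x hx
  exact hr.size_le.trans ht

theorem congr {f g : α → β} (hf : PolyOn S f) (h : ∀ k, ∀ x ∈ S k, f x = g x) : PolyOn S g := by
  obtain ⟨p, hp⟩ := hf
  refine ⟨p, fun k => ?_⟩
  obtain ⟨q, hq⟩ := hp k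
  exact ⟨q, fun x hx => h k x hx ▸ hq x hx⟩

theorem mono {T : ι → Set α} {f : α → β} (hf : PolyOn T f) (h : ∀ k, ∃ i, S k ⊆ T i) :
    PolyOn S f := by
  obtain ⟨p, hp⟩ := hf
  refine ⟨p, fun k => ?_⟩
  obtain ⟨i, hi⟩ := h k
  obtain ⟨q, hq⟩ := hp i
  exact ⟨q, fun x hx => hq x (hi hx)⟩

/-- A composition, where the sets match only up to a change of the parameter. -/
theorem comp_of {T : ι → Set β} {g : β → γ} {f : α → β} (hg : PolyOn T g) (hf : PolyOn S f)
    (h : ∀ k, ∃ i, ∀ x ∈ S k, f x ∈ T i) : PolyOn S (fun x => g (f x)) := by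
  obtain ⟨p, hp⟩ := hf
  obtain ⟨p', hp'⟩ := hg
  refine ⟨.comp p' p, fun k => ?_⟩
  obtain ⟨q, hq⟩ := hp k
  obtain ⟨i, hi⟩ := h k
  obtain ⟨q', hq'⟩ := hp' i
  refine ⟨q + q'.comp q + 1, fun x hx => ?_⟩
  obtain ⟨t, ht, hr⟩ := hq x hx
  obtain ⟨t', ht', hr'⟩ := hq' (f x) (hi x hx)
  refine ⟨_, ?_, .comp hr hr'⟩
  have : q'.eval (sz (f x)) ≤ q'.eval (q.eval (sz x)) :=
    Polynomial.eval_mono_nat _ (hr.size_le.trans ht)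
  simp only [Polynomial.eval_add, Polynomial.eval_comp, Polynomial.eval_one]
  omega

theorem comp {g : β → γ} {f : α → β} (hg : PolyOn (fun _ : Unit => Set.univ) g)
    (hf : PolyOn S f) : PolyOn S (fun x => g (f x)) :=
  comp_of hg hf fun _ => ⟨(), fun _ _ => trivial⟩

/-- A primitive operation applied to the result of a function. -/
theorem prim (o : PrimOp) {f : α → β} {g : α → γ} (hf : PolyOn S f)
    (h : ∀ k, ∀ x ∈ S k, o.eval (Enc.enc (f x)) = Enc.enc (g x))
    (hs : ∃ c, ∀ k, ∀ x ∈ S k, sz (g x) ≤ c + 2 * sz (f x)) : PolyOn S g := by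
  obtain ⟨p, hp⟩ := hf
  refine ⟨.comp (.prim o) p, fun k => ?_⟩
  obtain ⟨q, hq⟩ := hp k
  obtain ⟨c, hc⟩ := hs
  refine ⟨4 * q + Polynomial.C (c + 1), fun x hx => ?_⟩
  obtain ⟨t, ht, hr⟩ := hq x hx
  have h1 := Program.Run.prim o (Enc.enc (f x))
  rw [h k x hx] at h1
  refine ⟨_, ?_, .comp hr h1⟩
  have h2 := hr.size_le
  have h3 := hc k x hx
  simp only [sz] at h3
  simp only [Polynomial.eval_add, Polynomial.eval_mul, Polynomial.eval_C, Polynomial.eval_ofNat]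
  omega

theorem id : PolyOn S (fun x => x) := by
  refine ⟨.prim .id, fun k => ⟨2 * Polynomial.X, fun x _ => ⟨_, ?_, .prim _ _⟩⟩⟩
  simp only [PrimOp.eval, sz, Polynomial.eval_mul, Polynomial.eval_ofNat, Polynomial.eval_X]
  omega

theorem pair {f : α → β} {g : α → γ} (hf : PolyOn S f) (hg : PolyOn S g) :
    PolyOn S (fun x => (f x, g x)) := by
  obtain ⟨p, hp⟩ := hf
  obtain ⟨p', hp'⟩ := hg
  refine ⟨.pair p p', fun k => ?_⟩
  obtain ⟨q, hq⟩ := hp k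
  obtain ⟨q', hq'⟩ := hp' k
  refine ⟨q + q' + Polynomial.X + 1, fun x hx => ?_⟩
  obtain ⟨t, ht, hr⟩ := hq x hx
  obtain ⟨t', ht', hr'⟩ := hq' x hx
  refine ⟨_, ?_, .pair hr hr'⟩
  simp only [Polynomial.eval_add, Polynomial.eval_X, Polynomial.eval_one]
  simp only [sz] at *
  omega

theorem fst {f : α → β × γ} (hf : PolyOn S f) : PolyOn S (fun x => (f x).1) :=
  prim .fst hf (fun _ _ _ => rfl) ⟨0, fun k x _ => by
    have : sz (f x) = sz (f x).1 + sz (f x).2 + 1 := rfl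
    omega⟩

theorem snd {f : α → β × γ} (hf : PolyOn S f) : PolyOn S (fun x => (f x).2) :=
  prim .snd hf (fun _ _ _ => rfl) ⟨0, fun k x _ => by
    have : sz (f x) = sz (f x).1 + sz (f x).2 + 1 := rfl
    omega⟩

theorem const (z : ℤ) : PolyOn S (fun _ => z) :=
  prim (.const z) id (fun _ _ _ => rfl) ⟨sz z, fun _ _ _ => by omega⟩

theorem nil : PolyOn S (fun _ => ([] : List β)) :=
  prim (.const 0) id (fun _ _ _ => rfl) ⟨1, fun _ _ _ => by rw [sz_nil]; omega⟩

/-- A nonempty list is encoded as the pair of its head and tail, so pairing already builds it. -/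
theorem cons {f : α → β} {g : α → List β} (hf : PolyOn S f) (hg : PolyOn S g) :
    PolyOn S (fun x => f x :: g x) :=
  pair hf hg

theorem num {f : α → ℚ} (hf : PolyOn S f) : PolyOn S (fun x => (f x).num) :=
  prim .fst hf (fun _ _ _ => rfl) ⟨0, fun k x _ => by
    have : sz (f x) = sz (f x).num + sz ((f x).den : ℤ) + 1 := rfl
    omega⟩

theorem den {f : α → ℚ} (hf : PolyOn S f) : PolyOn S (fun x => ((f x).den : ℤ)) :=
  prim .snd hf (fun _ _ _ => rfl) ⟨0, fun k x _ => by
    have : sz (f x) = sz (f x).num + sz ((f x).den : ℤ) + 1 := rfl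
    omega⟩

theorem add {f g : α → ℤ} (hf : PolyOn S f) (hg : PolyOn S g) : PolyOn S (fun x => f x + g x) :=
  prim .add (pair hf hg) (fun _ _ _ => rfl) ⟨0, fun k x _ => by
    have := sz_add_le (f x) (g x)
    rw [sz_pair]; omega⟩

theorem sub {f g : α → ℤ} (hf : PolyOn S f) (hg : PolyOn S g) : PolyOn S (fun x => f x - g x) :=
  prim .sub (pair hf hg) (fun _ _ _ => rfl) ⟨0, fun k x _ => by
    have := sz_add_le (f x) (-g x)
    rw [← sub_eq_add_neg, sz_int (-g x), Int.natAbs_neg, ← sz_int] at this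
    rw [sz_pair]; omega⟩

theorem mul {f g : α → ℤ} (hf : PolyOn S f) (hg : PolyOn S g) : PolyOn S (fun x => f x * g x) :=
  prim .mul (pair hf hg) (fun _ _ _ => rfl) ⟨0, fun k x _ => by
    have := sz_mul_le (f x) (g x)
    rw [sz_pair]; omega⟩

theorem div {f g : α → ℤ} (hf : PolyOn S f) (hg : PolyOn S g) : PolyOn S (fun x => f x / g x) :=
  prim .div (pair hf hg) (fun _ _ _ => rfl) ⟨0, fun k x _ => by
    have h : ((f x) / (g x)).natAbs ≤ (f x).natAbs := Int.natAbs_ediv_le_natAbs _ _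
    have := Nat.size_le_size h
    rw [sz_pair, sz_int, sz_int]; omega⟩

theorem le {f g : α → ℤ} (hf : PolyOn S f) (hg : PolyOn S g) :
    PolyOn S (fun x => decide (f x ≤ g x)) :=
  prim .le (pair hf hg)
    (fun _ x _ => by by_cases h : f x ≤ g x <;> simp [Enc.enc, PrimOp.eval, h])
    ⟨2, fun k x _ => by
      by_cases h : f x ≤ g x <;> simp [sz, Enc.enc, h, Data.size]; omega⟩

theorem isCons {f : α → List β} (hf : PolyOn S f) : PolyOn S (fun x => !(f x).isEmpty) :=
  prim .isPair hf
    (fun _ x _ => by cases h : f x <;> simp [Enc.enc, PrimOp.eval, Data.ofList])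
    ⟨2, fun k x _ => by cases h : f x <;> simp [sz, Enc.enc, Data.size]; omega⟩

/-- Nonemptiness matters: on the code of `[]` the operation `fst` returns the integer `0`, which
need not encode the default element. -/
theorem headI [Inhabited β] {f : α → List β} (hf : PolyOn S f) (h : ∀ k, ∀ x ∈ S k, f x ≠ []) :
    PolyOn S (fun x => (f x).headI) := by
  refine prim .fst hf (fun k x hx => ?_) ⟨0, fun k x hx => ?_⟩
  · obtain ⟨b, l, hl⟩ := List.exists_cons_of_ne_nil (h k x hx)
    simp [hl, Enc.enc, PrimOp.eval, Data.ofList]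
  · obtain ⟨b, l, hl⟩ := List.exists_cons_of_ne_nil (h k x hx)
    rw [hl, sz_cons, List.headI_cons]
    omega

/-- The empty list needs no exception: `snd` sends its code, the integer `0`, to itself. -/
theorem tail {f : α → List β} (hf : PolyOn S f) : PolyOn S (fun x => (f x).tail) := by
  refine prim .snd hf (fun k x hx => ?_) ⟨0, fun k x hx => ?_⟩
  · cases h : f x <;> simp [Enc.enc, PrimOp.eval, Data.ofList]
  · cases h : f x
    · simp [sz_nil]
    · simp only [sz_cons, List.tail_cons]; omega

/-- Each branch is only required to be polynomial where the test selects it; this is what discharges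
the nonemptiness condition of `headI`. -/
theorem ite {c : α → Bool} {f g : α → β} (hc : PolyOn S c)
    (hf : PolyOn (fun k => {x ∈ S k | c x = true}) f)
    (hg : PolyOn (fun k => {x ∈ S k | c x = false}) g) :
    PolyOn S (fun x => if c x = true then f x else g x) := by
  obtain ⟨pc, hpc⟩ := hc
  obtain ⟨p, hp⟩ := hf
  obtain ⟨p', hp'⟩ := hg
  refine ⟨.ite pc p p', fun k => ?_⟩
  obtain ⟨qc, hqc⟩ := hpc k
  obtain ⟨q, hq⟩ := hp k
  obtain ⟨q', hq'⟩ := hp' k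
  refine ⟨qc + q + q' + Polynomial.X, fun x hx => ?_⟩
  obtain ⟨s, hs, hrc⟩ := hqc x hx
  have key : ∀ t, t ≤ q.eval (sz x) ∨ t ≤ q'.eval (sz x) →
      s + t + (Enc.enc x).size ≤ (qc + q + q' + Polynomial.X).eval (sz x) := fun t ht => by
    simp only [Polynomial.eval_add, Polynomial.eval_X]
    simp only [sz] at *
    omega
  cases h : c x with
  | true =>
    obtain ⟨t, ht, hr⟩ := hq x ⟨hx, h⟩
    rw [h] at hrc
    simp only [h, if_true]
    exact ⟨_, key t (.inl ht), .ite_true hrc (by simp [Enc.enc]) hr⟩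
  | false =>
    obtain ⟨t, ht, hr⟩ := hq' x ⟨hx, h⟩
    rw [h] at hrc
    simp only [h, Bool.false_eq_true, if_false]
    exact ⟨_, key t (.inr ht), .ite_false hrc hr⟩

theorem ite_le {a b : α → ℤ} {f g : α → β} (ha : PolyOn S a) (hb : PolyOn S b) (hf : PolyOn S f)
    (hg : PolyOn S g) : PolyOn S (fun x => if a x ≤ b x then f x else g x) := by
  refine (ite (le ha hb) (hf.mono fun k => ⟨k, fun x hx => hx.1⟩)
    (hg.mono fun k => ⟨k, fun x hx => hx.1⟩)).congr fun _ x _ => ?_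
  simp

end PolyOn

/-- The cost of a loop whose states, tests and steps all cost at most `B`. -/
theorem Program.Run.loop_of_le {pc pf : Program} {B : ℕ} (N : ℕ) (d : ℕ → Data)
    (hd : ∀ i ≤ N, (d i).size ≤ B)
    (hc : ∀ i < N, ∃ s ≤ B, pc.Run (d i) (.int 1) s)
    (hf : ∀ i < N, ∃ s ≤ B, pf.Run (d i) (d (i + 1)) s)
    (hN : ∃ s ≤ B, pc.Run (d N) (.int 0) s) :
    ∃ t ≤ (N + 1) * (3 * B), (Program.loop pc pf).Run (d 0) (d N) t := by
  induction N generalizing d with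
  | zero =>
    obtain ⟨s, hs, hr⟩ := hN
    have := hd 0 le_rfl
    exact ⟨s + (d 0).size, by omega, by constructor; exact hr⟩
  | succ N ih =>
    obtain ⟨u, hu, hru⟩ := ih (fun i => d (i + 1)) (fun i hi => hd _ (by omega))
      (fun i hi => hc _ (by omega)) (fun i hi => hf _ (by omega)) hN
    obtain ⟨s, hs, hrs⟩ := hc 0 (by omega)
    obtain ⟨t, ht, hrt⟩ := hf 0 (by omega)
    have := hd 0 (by omega)
    refine ⟨_, ?_, .loop_step hrs (by simp) hrt hru⟩
    rw [add_mul (N + 1)]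
    omega

/-! ### Loops and folds -/

namespace PolyOn

variable {κ ι α β γ δ : Type} [Enc α] [Enc β] [Enc γ] [Enc δ] {S : κ → Set α}

/-- A while loop with polynomially many iterations and states of polynomial size. -/
theorem iterate {T : κ → Set α} {c : α → Bool} {f : α → α} (hc : PolyOn T c)
    (hf : PolyOn (fun k => {x ∈ T k | c x = true}) f) (N : α → ℕ)
    (hT : ∀ k, ∀ x ∈ S k, ∀ i ≤ N x, f^[i] x ∈ T k)
    (htrue : ∀ k, ∀ x ∈ S k, ∀ i < N x, c (f^[i] x) = true)
    (hfalse : ∀ k, ∀ x ∈ S k, c (f^[N x] x) = false)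
    (hN : ∀ k, ∃ q : Polynomial ℕ, ∀ x ∈ S k, N x ≤ q.eval (sz x))
    (hsize : ∀ k, ∃ q : Polynomial ℕ, ∀ x ∈ S k, ∀ i ≤ N x, sz (f^[i] x) ≤ q.eval (sz x)) :
    PolyOn S (fun x => f^[N x] x) := by
  obtain ⟨pc, hpc⟩ := hc
  obtain ⟨pf, hpf⟩ := hf
  refine ⟨.loop pc pf, fun k => ?_⟩
  obtain ⟨qc, hqc⟩ := hpc k
  obtain ⟨qf, hqf⟩ := hpf k
  obtain ⟨qN, hqN⟩ := hN k
  obtain ⟨qs, hqs⟩ := hsize k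
  refine ⟨(qN + 1) * (3 * (qs + qc.comp qs + qf.comp qs)), fun x hx => ?_⟩
  set B := (qs + qc.comp qs + qf.comp qs).eval (sz x) with hB
  simp only [Polynomial.eval_add, Polynomial.eval_comp] at hB
  obtain ⟨t, ht, hr⟩ := Program.Run.loop_of_le (pc := pc) (pf := pf) (B := B) (N x)
    (fun i => Enc.enc (f^[i] x)) (fun i hi => (hqs x hx i hi).trans (by omega))
    (fun i hi => by
      obtain ⟨s, hs, hr⟩ := hqc _ (hT k x hx i hi.le)
      rw [htrue k x hx i hi] at hr
      have := Polynomial.eval_mono_nat qc (hqs x hx i hi.le)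
      exact ⟨s, by omega, hr⟩)
    (fun i hi => by
      obtain ⟨s, hs, hr⟩ := hqf _ ⟨hT k x hx i hi.le, htrue k x hx i hi⟩
      rw [← Function.iterate_succ_apply' f] at hr
      have := Polynomial.eval_mono_nat qf (hqs x hx i hi.le)
      exact ⟨s, by omega, hr⟩)
    (by
      obtain ⟨s, hs, hr⟩ := hqc _ (hT k x hx _ le_rfl)
      rw [hfalse k x hx] at hr
      have := Polynomial.eval_mono_nat qc (hqs x hx _ le_rfl)
      exact ⟨s, by omega, hr⟩)
  refine ⟨t, ht.trans ?_, hr⟩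
  simp only [Polynomial.eval_mul, Polynomial.eval_add, Polynomial.eval_one, Polynomial.eval_ofNat,
    hB, Polynomial.eval_comp]
  gcongr
  exact hqN x hx

/-- A left fold whose accumulator has polynomial size. -/
theorem foldl_of_size [Inhabited β] {l : α → List β} {init : α → γ} {step : α × (γ × β) → γ}
    (hl : PolyOn S l) (hi : PolyOn S init) (hstep : PolyOn (extend S) step)
    (hsize : ∀ k, ∃ q : Polynomial ℕ, ∀ x ∈ S k, ∀ i ≤ (l x).length,
      sz (((l x).take i).foldl (fun a b => step (x, (a, b))) (init x)) ≤ q.eval (sz x)) :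
    PolyOn S (fun x => (l x).foldl (fun a b => step (x, (a, b))) (init x)) := by
  -- A loop state holds the input, the accumulator and the unread part of the list. `T` is the
  -- invariant; `R` describes the initial states.
  let T : κ → Set (α × (γ × List β)) := extend S
  let R : κ → Set (α × (γ × List β)) :=
    fun k => {s | s.1 ∈ S k ∧ s.2.1 = init s.1 ∧ s.2.2 = l s.1}
  let c : α × (γ × List β) → Bool := fun s => !s.2.2.isEmpty
  let f : α × (γ × List β) → α × (γ × List β) :=
    fun s => (s.1, (step (s.1, (s.2.1, s.2.2.headI)), s.2.2.tail))
  have hiter : ∀ (x : α) (a : γ) (L : List β) (i : ℕ), i ≤ L.length → f^[i] (x, (a, L)) =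
      (x, ((L.take i).foldl (fun a b => step (x, (a, b))) a, L.drop i)) := by
    intro x a L i
    induction i generalizing a L with
    | zero => intro _; simp
    | succ i ih =>
      intro hi
      cases L with
      | nil => simp at hi
      | cons b L =>
        rw [Function.iterate_succ_apply]
        exact ih _ _ (by simpa using hi)
  have hloop : PolyOn R (fun s => f^[s.2.2.length] s) := by
    refine iterate (T := T) (c := c) (isCons id.snd.snd) ?_ (fun s => s.2.2.length) ?_ ?_ ?_ ?_ ?_
    · refine pair id.fst (pair (comp_of hstep (pair id.fst (pair id.snd.fst (headI id.snd.snd ?_)))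
        fun k => ⟨k, fun x hx => hx.1⟩) (tail id.snd.snd))
      rintro k x ⟨-, hx⟩ h
      simp [c, h] at hx
    · rintro k ⟨x, a, L⟩ hx i hi
      rw [hiter _ _ _ _ hi]
      exact hx.1
    · rintro k ⟨x, a, L⟩ hx i hi
      rw [hiter _ _ _ _ hi.le]
      simpa [c, List.isEmpty_iff] using hi
    · rintro k ⟨x, a, L⟩ hx
      rw [hiter _ _ _ _ le_rfl]
      simp [c]
    · refine fun k => ⟨Polynomial.X, ?_⟩
      rintro ⟨x, a, L⟩ hx
      have := length_le_sz L
      simp only [Polynomial.eval_X, sz_pair]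
      omega
    · intro k
      obtain ⟨q, hq⟩ := hsize k
      refine ⟨q + Polynomial.X, ?_⟩
      rintro ⟨x, a, L⟩ ⟨hx, ha, hL⟩ i hi
      dsimp only at hx ha hL hi
      subst ha hL
      rw [hiter _ _ _ _ hi]
      have h1 := hq x hx i hi
      have h2 := sz_drop_le (l x) i
      have h3 := q.eval_mono_nat (show sz x ≤ sz (x, (init x, l x)) by rw [sz_pair]; omega)
      have h4 := one_le_sz (init x)
      simp only [Polynomial.eval_add, Polynomial.eval_X, sz_pair] at *
      omega
  refine ((hloop.comp_of (pair id (pair hi hl))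
    fun k => ⟨k, fun x hx => ⟨hx, rfl, rfl⟩⟩).snd.fst).congr
    fun k x _ => ?_
  dsimp only
  rw [hiter _ _ _ _ le_rfl, List.take_length]

/-- A left fold in which the size of the accumulator grows by a bounded amount in every step. -/
theorem foldl_of_growth [Inhabited β] {l : α → List β} {init : α → γ} {step : α × (γ × β) → γ}
    (hl : PolyOn S l) (hi : PolyOn S init) (hstep : PolyOn (extend S) step)
    (hgrow : ∀ k, ∃ q : Polynomial ℕ, ∀ x ∈ S k, ∀ a b,
      sz (step (x, (a, b))) ≤ sz a + q.eval (sz x + sz b)) :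
    PolyOn S (fun x => (l x).foldl (fun a b => step (x, (a, b))) (init x)) := by
  refine foldl_of_size hl hi hstep fun k => ?_
  obtain ⟨q, hq⟩ := hgrow k
  obtain ⟨ql, hql⟩ := hl.size_bound k
  obtain ⟨qi, hqi⟩ := hi.size_bound k
  refine ⟨qi + ql * q.comp (Polynomial.X + ql), fun x hx i hi => ?_⟩
  have key : ∀ (L : List β) (a : γ) (B : ℕ), (∀ b ∈ L, q.eval (sz x + sz b) ≤ B) →
      sz (L.foldl (fun a b => step (x, (a, b))) a) ≤ sz a + L.length * B := by
    intro L
    induction L with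
    | nil => intro a B _; simp
    | cons b L ih =>
      intro a B hB
      rw [List.foldl_cons, List.length_cons]
      have h1 := ih (step (x, (a, b))) B fun b' hb' => hB b' (List.mem_cons_of_mem _ hb')
      have h2 := hq x hx a b
      have h3 := hB b List.mem_cons_self
      rw [add_mul]
      omega
  refine (key _ _ (q.eval (sz x + ql.eval (sz x))) fun b hb => ?_).trans ?_
  · have := sz_le_of_mem (List.mem_of_mem_take hb)
    have := hql x hx
    exact q.eval_mono_nat (by omega)
  · simp only [Polynomial.eval_add, Polynomial.eval_mul, Polynomial.eval_comp, Polynomial.eval_X]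
    gcongr
    · exact hqi x hx
    · exact ((List.length_take_le _ _).trans hi).trans ((length_le_sz _).trans (hql x hx))

/-- A left fold over lists of bounded length. -/
theorem foldl_of_length [Inhabited β] {l : α → List β} {init : α → γ} {step : α × (γ × β) → γ}
    (hl : PolyOn S l) (hi : PolyOn S init) (hstep : PolyOn (extend S) step)
    (hlen : ∀ k, ∃ c, ∀ x ∈ S k, (l x).length ≤ c) :
    PolyOn S (fun x => (l x).foldl (fun a b => step (x, (a, b))) (init x)) := by
  refine foldl_of_size hl hi hstep fun k => ?_
  obtain ⟨c, hc⟩ := hlen k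
  obtain ⟨ql, hql⟩ := hl.size_bound k
  obtain ⟨qi, hqi⟩ := hi.size_bound k
  obtain ⟨qs, hqs⟩ := hstep.size_bound k
  -- Every step composes the previous bound with that of `step`, so the degree may grow with `c`; a
  -- bounded number of steps keeps it polynomial.
  have key : ∀ c : ℕ, ∃ q : Polynomial ℕ, ∀ x ∈ S k, ∀ i ≤ (l x).length, i ≤ c →
      sz (((l x).take i).foldl (fun a b => step (x, (a, b))) (init x)) ≤ q.eval (sz x) := by
    intro c
    induction c with
    | zero =>
      refine ⟨qi, fun x hx i _ hi => ?_⟩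
      obtain rfl : i = 0 := by omega
      exact hqi x hx
    | succ c ih =>
      obtain ⟨q, hq⟩ := ih
      refine ⟨qi + qs.comp (Polynomial.X + q + ql + 2), fun x hx i hi hic => ?_⟩
      cases i with
      | zero =>
        have := hqi x hx
        simp only [Polynomial.eval_add, List.take_zero, List.foldl_nil]
        omega
      | succ i =>
        rw [List.take_succ_eq_append_getElem (by omega), List.foldl_append, List.foldl_cons, List.foldl_nil]
        have h1 := hq x hx i (by omega) (by omega)
        set a := ((l x).take i).foldl (fun a b => step (x, (a, b))) (init x)
        have h2 := hqs (x, (a, (l x)[i])) hx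
        have h3 := sz_le_of_mem (List.getElem_mem (l := l x) (n := i) (by omega))
        have h4 := hql x hx
        have h5 := qs.eval_mono_nat (show sz (x, (a, (l x)[i])) ≤
          sz x + q.eval (sz x) + ql.eval (sz x) + 2 by simp only [sz_pair]; omega)
        simp only [Polynomial.eval_add, Polynomial.eval_comp, Polynomial.eval_X,
          Polynomial.eval_ofNat]
        omega
  obtain ⟨q, hq⟩ := key c
  exact ⟨q, fun x hx i hi => hq x hx i hi (hi.trans (hc x hx))⟩

end PolyOn

/-! ### Polynomial-time operations on lists -/

namespace PolyOn

variable {κ ι α β γ δ : Type} [Enc α] [Enc β] [Enc γ] [Enc δ] {S : κ → Set α}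

theorem reverse [Inhabited β] {l : α → List β} (hl : PolyOn S l) :
    PolyOn S (fun x => (l x).reverse) := by
  refine (foldl_of_growth (step := fun y => y.2.2 :: y.2.1) hl nil (cons id.snd.snd id.snd.fst)
    fun k => ⟨Polynomial.X + 1, fun x _ a b => ?_⟩).congr fun _ x _ => ?_
  · simp only [sz_cons, Polynomial.eval_add, Polynomial.eval_X, Polynomial.eval_one]
    omega
  · simp

theorem append [Inhabited β] {l l' : α → List β} (hl : PolyOn S l) (hl' : PolyOn S l') :
    PolyOn S (fun x => l x ++ l' x) := by
  refine (foldl_of_growth (step := fun y => y.2.2 :: y.2.1) hl.reverse hl'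
    (cons id.snd.snd id.snd.fst) fun k => ⟨Polynomial.X + 1, fun x _ a b => ?_⟩).congr
    fun _ x _ => ?_
  · simp only [sz_cons, Polynomial.eval_add, Polynomial.eval_X, Polynomial.eval_one]
    omega
  · simp

theorem map [Inhabited β] [Inhabited γ] {l : α → List β} {f : α × β → γ} (hl : PolyOn S l)
    (hf : PolyOn (extend S) f) : PolyOn S (fun x => (l x).map fun b => f (x, b)) := by
  refine (foldl_of_growth (step := fun y => f (y.1, y.2.2) :: y.2.1) hl nil
    (cons (hf.comp_of (pair id.fst id.snd.snd) fun k => ⟨k, fun _ h => h⟩) id.snd.fst)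
    fun k => ?_).reverse.congr fun _ x _ => ?_
  · obtain ⟨q, hq⟩ := hf.size_bound k
    refine ⟨q.comp (Polynomial.X + 1) + 1, fun x hx a b => ?_⟩
    have := hq (x, b) hx
    simp only [sz_pair] at this
    simp only [sz_cons, Polynomial.eval_add, Polynomial.eval_X, Polynomial.eval_one,
      Polynomial.eval_comp]
    omega
  · simp

theorem sum {l : α → List ℤ} (hl : PolyOn S l) : PolyOn S (fun x => (l x).sum) := by
  refine (foldl_of_growth (step := fun y => y.2.1 + y.2.2) hl (const 0)
    (add id.snd.fst id.snd.snd) fun k => ⟨Polynomial.X, fun x _ a b => ?_⟩).congr fun _ x _ => ?_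
  · have := sz_add_le a b
    simp only [Polynomial.eval_X]
    omega
  · exact List.sum_eq_foldl.symm

theorem prod {l : α → List ℤ} (hl : PolyOn S l) : PolyOn S (fun x => (l x).prod) := by
  refine (foldl_of_growth (step := fun y => y.2.1 * y.2.2) hl (const 1)
    (mul id.snd.fst id.snd.snd) fun k => ⟨Polynomial.X, fun x _ a b => ?_⟩).congr fun _ x _ => ?_
  · have := sz_mul_le a b
    simp only [Polynomial.eval_X]
    omega
  · exact List.prod_eq_foldl.symm

theorem flatten [Inhabited β] {l : α → List (List β)} (hl : PolyOn S l) :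
    PolyOn S (fun x => (l x).flatten) := by
  refine (foldl_of_growth (step := fun y => y.2.1 ++ y.2.2) hl nil
    (append id.snd.fst id.snd.snd) fun k => ⟨Polynomial.X, fun x _ a b => ?_⟩).congr fun _ x _ => ?_
  · have := sz_append a b
    simp only [Polynomial.eval_X]
    omega
  · have : ∀ (L : List (List β)) (a : List β),
        L.foldl (fun a b => a ++ b) a = a ++ L.flatten := by
      intro L
      induction L with
      | nil => simp
      | cons b L ih => intro a; simp [ih]
    simpa using this (l x) []

theorem flatMap [Inhabited β] [Inhabited γ] {l : α → List β} {f : α × β → List γ}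
    (hl : PolyOn S l) (hf : PolyOn (extend S) f) :
    PolyOn S (fun x => (l x).flatMap fun b => f (x, b)) :=
  (map hl hf).flatten

theorem zip [Inhabited β] [Inhabited γ] {l : α → List β} {l' : α → List γ} (hl : PolyOn S l)
    (hl' : PolyOn S l') : PolyOn S (fun x => (l x).zip (l' x)) := by
  -- The accumulator is the unread part of the second list with the reversed output; it stays fixed
  -- once that list is exhausted.
  let step : α × ((List γ × List (β × γ)) × β) → List γ × List (β × γ) := fun y =>
    if (!y.2.1.1.isEmpty) = true then (y.2.1.1.tail, (y.2.2, y.2.1.1.headI) :: y.2.1.2) else y.2.1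
  refine ((foldl_of_growth (step := step) hl (pair hl' nil) ?_ fun k =>
    ⟨Polynomial.X + 2, fun x _ a b => ?_⟩).snd.reverse).congr fun _ x _ => ?_
  · refine ite (isCons id.snd.fst.fst) (pair (tail id.snd.fst.fst)
      (cons (pair id.snd.snd (headI id.snd.fst.fst ?_)) id.snd.fst.snd)) id.snd.fst
    rintro k y ⟨-, hy⟩ h
    simp [h] at hy
  · obtain ⟨_ | ⟨c, L⟩, out⟩ := a
    · simp [step]
    · simp only [step, List.isEmpty_cons, Bool.not_false, if_true, List.tail_cons, List.headI_cons,
        sz_pair, sz_cons, Polynomial.eval_add, Polynomial.eval_X, Polynomial.eval_ofNat]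
      omega
  · have : ∀ (L : List β) (L' : List γ) (out : List (β × γ)),
        (L.foldl (fun a b => step (x, (a, b))) (L', out)).2.reverse = out.reverse ++ L.zip L' := by
      intro L
      induction L with
      | nil => simp
      | cons b L ih =>
        intro L' out
        cases L' with
        | nil =>
          rw [List.foldl_cons, show step (x, (([], out), b)) = ([], out) by simp [step], ih]
          simp
        | cons c L' =>
          rw [List.foldl_cons, show step (x, ((c :: L', out), b)) = (L', (b, c) :: out) by
            simp [step], ih]
          simp
    simpa using this (l x) (l' x) []

/-- All choices from a bounded number of lists. -/
theorem sections [Inhabited β] {l : α → List (List β)} (hl : PolyOn S l)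
    (hlen : ∀ k, ∃ c, ∀ x ∈ S k, (l x).length ≤ c) : PolyOn S (fun x => (l x).sections) := by
  refine (foldl_of_length (step := fun y => y.2.1.flatMap fun s => y.2.2.map fun a => a :: s)
    hl.reverse (cons nil nil) ?_ (by simpa using hlen)).congr fun _ x _ => ?_
  · exact flatMap (f := fun z : (α × (List (List β) × List β)) × List β =>
      z.1.2.2.map fun a => a :: z.2) id.snd.fst
      (map (f := fun w => w.2 :: w.1.2) id.fst.snd.snd
        (cons (g := fun w : ((α × (List (List β) × List β)) × List β) × β => w.1.2)
          id.snd id.fst.snd))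
  · dsimp only
    rw [List.foldl_reverse]
    generalize l x = L
    induction L with
    | nil => rfl
    | cons b L ih => rw [List.foldr_cons, ih]; rfl

theorem headD [Inhabited β] {l : α → List β} {d : α → β} (hl : PolyOn S l) (hd : PolyOn S d) :
    PolyOn S (fun x => (l x).headD (d x)) := by
  refine (ite (isCons hl) (headI (hl.mono fun k => ⟨k, fun x hx => hx.1⟩) ?_)
    (hd.mono fun k => ⟨k, fun x hx => hx.1⟩)).congr fun _ x _ => ?_
  · rintro k y ⟨-, hy⟩ h
    simp [h] at hy
  · cases l x <;> simp

end PolyOn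

/-- The last entry of the list with maximal key, and `d` if the list is empty. -/
def argmax {β : Type} (d : ℤ × β) (l : List (ℤ × β)) : ℤ × β :=
  l.foldl (fun a b => if a.1 ≤ b.1 then b else a) (l.headD d)

theorem argmax_spec {β : Type} (d : ℤ × β) {l : List (ℤ × β)} (hl : l ≠ []) :
    argmax d l ∈ l ∧ ∀ b ∈ l, b.1 ≤ (argmax d l).1 := by
  have key : ∀ (L : List (ℤ × β)) (a : ℤ × β),
      (L.foldl (fun a b => if a.1 ≤ b.1 then b else a) a ∈ a :: L) ∧
      ∀ b ∈ a :: L, b.1 ≤ (L.foldl (fun a b => if a.1 ≤ b.1 then b else a) a).1 := by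
    intro L
    induction L with
    | nil => simp
    | cons c L ih =>
      intro a
      rw [List.foldl_cons]
      obtain ⟨h1, h2⟩ := ih (if a.1 ≤ c.1 then c else a)
      have h3 := h2 _ List.mem_cons_self
      constructor
      · rcases List.mem_cons.1 h1 with h | h
        · rw [h]; split_ifs <;> simp
        · simp [h]
      · intro b hb
        rcases List.mem_cons.1 hb with rfl | hb
        · refine le_trans ?_ h3; split_ifs <;> omega
        · rcases List.mem_cons.1 hb with rfl | hb
          · refine le_trans ?_ h3; split_ifs <;> omega
          · exact h2 b (List.mem_cons_of_mem _ hb)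
  obtain ⟨c, L, rfl⟩ := List.exists_cons_of_ne_nil hl
  -- The fold starts at the head and meets it again as its first entry, which is harmless.
  obtain ⟨h1, h2⟩ := key (c :: L) c
  refine ⟨?_, fun b hb => h2 b (List.mem_cons_of_mem _ hb)⟩
  rcases List.mem_cons.1 h1 with h | h
  · exact List.mem_cons.2 (.inl h)
  · exact h

theorem PolyOn.argmax {κ α β : Type} [Enc α] [Enc β] [Inhabited β] {S : κ → Set α}
    {d : α → ℤ × β} {l : α → List (ℤ × β)} (hd : PolyOn S d) (hl : PolyOn S l) :
    PolyOn S (fun x => argmax (d x) (l x)) := by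
  refine foldl_of_growth (step := fun y => if y.2.1.1 ≤ y.2.2.1 then y.2.2 else y.2.1) hl
    (headD hl hd) (ite_le id.snd.fst.fst id.snd.snd.fst id.snd.snd id.snd.fst)
    fun k => ⟨Polynomial.X, fun x _ a b => ?_⟩
  dsimp only
  rw [Polynomial.eval_X]
  split_ifs <;> omega

/-- The inner product of two lists. -/
def dot (a b : List ℤ) : ℤ := ((a.zip b).map fun y => y.1 * y.2).sum

theorem PolyOn.dot {κ α : Type} [Enc α] {S : κ → Set α} {f g : α → List ℤ}
    (hf : PolyOn S f) (hg : PolyOn S g) : PolyOn S (fun x => dot (f x) (g x)) :=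
  sum (map (f := fun y : α × (ℤ × ℤ) => y.2.1 * y.2.2) (zip hf hg) (mul id.snd.fst id.snd.snd))

/-! ### Orbits of integers -/

/-- The first `N` points of the orbit of `z` under `g`, the last one first. -/
def orbit (g : ℤ → ℤ) (N : ℕ) (z : ℤ) : List ℤ := ((List.range N).map fun i => g^[i] z).reverse

/-- The program never computes `N z`: it loops while the current value is at least `1`, which by
`hpos` and `hend` takes exactly `N z` rounds. -/
theorem PolyOn.orbit {κ : Type} {S : κ → Set ℤ} {g : ℤ → ℤ} {N : ℤ → ℕ}
    (hg : PolyOn (fun _ : Unit => Set.univ) g)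
    (hpos : ∀ k, ∀ z ∈ S k, ∀ i < N z, 1 ≤ g^[i] z)
    (hend : ∀ k, ∀ z ∈ S k, g^[N z] z < 1)
    (hN : ∀ k, ∃ q : Polynomial ℕ, ∀ z ∈ S k, N z ≤ q.eval (sz z))
    (hsize : ∀ k, ∀ z ∈ S k, ∀ i ≤ N z, sz (g^[i] z) ≤ sz z) :
    PolyOn S (fun z => orbit g (N z) z) := by
  let f : ℤ × List ℤ → ℤ × List ℤ := fun s => (g s.1, s.1 :: s.2)
  have hiter : ∀ z i, f^[i] (z, []) = (g^[i] z, _root_.orbit g i z) := by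
    intro z i
    induction i with
    | zero => rfl
    | succ i ih =>
      rw [Function.iterate_succ_apply', Function.iterate_succ_apply', ih]
      simp [f, _root_.orbit, List.range_succ]
  let R : κ → Set (ℤ × List ℤ) := fun k => {s | s.1 ∈ S k ∧ s.2 = []}
  have hloop : PolyOn R (fun s => f^[N s.1] s) := by
    refine iterate (T := fun _ => Set.univ) (c := fun s => decide (1 ≤ s.1)) (le (const 1) id.fst)
      (pair (hg.comp id.fst) (cons id.fst id.snd)) (fun s => N s.1) ?_ ?_ ?_ ?_ ?_
    · exact fun _ _ _ _ _ => trivial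
    · rintro k ⟨z, _⟩ ⟨hz, rfl⟩ i hi
      rw [hiter]
      simpa using hpos k z hz i hi
    · rintro k ⟨z, _⟩ ⟨hz, rfl⟩
      rw [hiter]
      simpa using hend k z hz
    · intro k
      obtain ⟨q, hq⟩ := hN k
      refine ⟨q, ?_⟩
      rintro ⟨z, _⟩ ⟨hz, rfl⟩
      refine (hq z hz).trans (q.eval_mono_nat ?_)
      rw [sz_pair]; omega
    · intro k
      obtain ⟨q, hq⟩ := hN k
      refine ⟨Polynomial.X + q * (Polynomial.X + 1) + 1, ?_⟩
      rintro ⟨z, _⟩ ⟨hz, rfl⟩ i hi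
      dsimp only at hz hi
      rw [hiter]
      have h1 : ∀ j ≤ i, sz (_root_.orbit g j z) ≤ j * (sz z + 1) + 1 := by
        intro j
        induction j with
        | zero => intro _; simp [_root_.orbit, sz_nil]
        | succ j ih =>
          intro hj
          rw [show _root_.orbit g (j + 1) z = g^[j] z :: _root_.orbit g j z by
            simp [_root_.orbit, List.range_succ], sz_cons, add_mul]
          have := ih (by omega)
          have := hsize k z hz j (by omega)
          omega
      have h2 := h1 i le_rfl
      have h3 := hsize k z hz i hi
      have h4 : q.eval (sz z) ≤ q.eval (sz (z, ([] : List ℤ))) :=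
        q.eval_mono_nat (by rw [sz_pair]; omega)
      have h5 : i * (sz z + 1) ≤ q.eval (sz (z, ([] : List ℤ))) * (sz (z, ([] : List ℤ)) + 1) := by
        gcongr
        · exact hi.trans ((hq z hz).trans h4)
        · rw [sz_pair]; omega
      simp only [Polynomial.eval_add, Polynomial.eval_mul, Polynomial.eval_X, Polynomial.eval_one]
      have h6 : sz (z, ([] : List ℤ)) = sz z + 1 + 1 := rfl
      rw [sz_pair]
      omega
  refine (hloop.comp_of (pair id nil) fun k => ⟨k, fun x hx => ⟨hx, rfl⟩⟩).snd.congr fun k x _ => ?_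
  dsimp only
  rw [hiter]

theorem sz_le_sz_of_nonneg {a b : ℤ} (ha : 0 ≤ a) (h : a ≤ b) : sz a ≤ sz b := by
  rw [sz_int, sz_int]
  have := Nat.size_le_size (show a.natAbs ≤ b.natAbs by omega)
  omega

/-- The integers from `1` to `z`. -/
def countdown (z : ℤ) : List ℤ := orbit (fun y => y - 1) z.toNat z

theorem iterate_sub_one (z : ℤ) (i : ℕ) : (fun y : ℤ => y - 1)^[i] z = z - i := by
  induction i with
  | zero => simp
  | succ i ih => rw [Function.iterate_succ_apply', ih]; push_cast; ring

theorem mem_countdown {z j : ℤ} : j ∈ countdown z ↔ 1 ≤ j ∧ j ≤ z := by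
  simp only [countdown, orbit, List.mem_reverse, List.mem_map, List.mem_range, iterate_sub_one]
  constructor
  · rintro ⟨i, hi, rfl⟩; omega
  · rintro ⟨h1, h2⟩; exact ⟨(z - j).toNat, by omega, by omega⟩

theorem length_countdown (z : ℤ) : (countdown z).length = z.toNat := by
  simp [countdown, orbit]

/-- The length of the list is the value of `f x`, which can be exponential in its bit size; hence
the bound depending on `k` alone. -/
theorem PolyOn.countdown {κ α : Type} [Enc α] {S : κ → Set α} {f : α → ℤ} (hf : PolyOn S f)
    (hb : ∀ k, ∃ c : ℕ, ∀ x ∈ S k, 0 ≤ f x ∧ f x ≤ c) : PolyOn S (fun x => countdown (f x)) := by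
  have h : PolyOn (fun c : ℕ => {z : ℤ | 0 ≤ z ∧ z ≤ c}) _root_.countdown := by
    refine PolyOn.orbit (sub id (const 1)) ?_ ?_ (fun c => ⟨Polynomial.C c, ?_⟩) ?_
    · rintro c z ⟨h0, hc⟩ i hi
      rw [iterate_sub_one]; omega
    · rintro c z ⟨h0, hc⟩
      rw [iterate_sub_one]; omega
    · rintro z ⟨h0, hc⟩
      rw [Polynomial.eval_C]; omega
    · rintro c z ⟨h0, hc⟩ i hi
      rw [iterate_sub_one]
      exact sz_le_sz_of_nonneg (by omega) (by omega)
  exact h.comp_of hf hb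

/-- The list of the iterated halves of `z` that are positive. -/
def halves (z : ℤ) : List ℤ := orbit (fun y => y / 2) z.toNat.size z

theorem iterate_half (z : ℤ) (i : ℕ) : (fun y : ℤ => y / 2)^[i] z = z / 2 ^ i := by
  induction i with
  | zero => simp
  | succ i ih => rw [Function.iterate_succ_apply', ih, pow_succ, Int.ediv_ediv_of_nonneg (by positivity)]

theorem mem_halves {z g : ℤ} : g ∈ halves z ↔ ∃ i < z.toNat.size, z / 2 ^ i = g := by
  simp only [halves, orbit, List.mem_reverse, List.mem_map, List.mem_range, iterate_half]

/-- Here the length of the list is the number of binary digits of `f x`, so no bound on the value is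
needed. -/
theorem PolyOn.halves {κ α : Type} [Enc α] {S : κ → Set α} {f : α → ℤ} (hf : PolyOn S f)
    (hb : ∀ k, ∀ x ∈ S k, 0 ≤ f x) : PolyOn S (fun x => halves (f x)) := by
  have h : PolyOn (fun _ : Unit => {z : ℤ | 0 ≤ z}) _root_.halves := by
    refine PolyOn.orbit (div id (const 2)) ?_ ?_ (fun c => ⟨Polynomial.X, ?_⟩) ?_
    · intro c z hz i hi
      rw [Nat.lt_size] at hi
      rw [iterate_half, Int.le_ediv_iff_mul_le (by positivity)]
      have h0 : 0 ≤ z := hz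
      have : ((2 ^ i : ℕ) : ℤ) ≤ z := by omega
      push_cast at this; omega
    · intro c z hz
      have h1 := Nat.lt_size_self z.toNat
      rw [iterate_half]
      have : z < ((2 ^ z.toNat.size : ℕ) : ℤ) := by omega
      push_cast at this
      refine Int.ediv_lt_of_lt_mul (by positivity) (by omega)
    · intro z hz
      have : z.natAbs = z.toNat := by have : 0 ≤ z := hz; omega
      rw [Polynomial.eval_X, sz_int, this]; omega
    · intro c z hz i hi
      rw [iterate_half]
      exact sz_le_sz_of_nonneg (Int.ediv_nonneg hz (by positivity)) (Int.ediv_le_self _ hz)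
  exact h.comp_of hf fun k => ⟨(), fun x hx => hb k x hx⟩

/-- Every real number below `z` is approximated from above by an iterated half of `z`. -/
theorem exists_mem_halves {z : ℤ} (hz : 1 ≤ z) {x : ℝ} (hx : x ≤ z) :
    ∃ g ∈ halves z, 1 ≤ g ∧ x ≤ g ∧ (g : ℝ) ≤ max 1 (2 * x + 1) := by
  classical
  have h1 : 0 < z.toNat.size := by rw [Nat.size_pos]; omega
  -- Halve as long as the result stays above `x` and positive. Either the next half falls below `x`,
  -- giving the bound `2 * x + 1`, or the value has reached `1`.
  let n := Nat.findGreatest (fun i => x ≤ ((z / 2 ^ i : ℤ) : ℝ)) (z.toNat.size - 1)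
  have hn1 : x ≤ ((z / 2 ^ n : ℤ) : ℝ) :=
    Nat.findGreatest_spec (P := fun i => x ≤ ((z / 2 ^ i : ℤ) : ℝ)) (Nat.zero_le _) (by simpa using hx)
  have hn2 : n ≤ z.toNat.size - 1 := Nat.findGreatest_le _
  have hpos : 1 ≤ z / 2 ^ n := by
    rw [Int.le_ediv_iff_mul_le (by positivity)]
    have h2 : n < z.toNat.size := by omega
    rw [Nat.lt_size] at h2
    have : ((2 ^ n : ℕ) : ℤ) ≤ z := by omega
    push_cast at this; omega
  refine ⟨z / 2 ^ n, mem_halves.2 ⟨n, by omega, rfl⟩, hpos, hn1, ?_⟩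
  have hhalf : z / 2 ^ n ≤ 2 * (z / 2 ^ (n + 1)) + 1 := by
    rw [pow_succ, ← Int.ediv_ediv_of_nonneg (by positivity)]; omega
  rcases Nat.lt_or_ge n (z.toNat.size - 1) with h | h
  · have h3 : ¬ x ≤ ((z / 2 ^ (n + 1) : ℤ) : ℝ) :=
      Nat.findGreatest_is_greatest (P := fun i => x ≤ ((z / 2 ^ i : ℤ) : ℝ)) (Nat.lt_succ_self n) h
    refine le_max_of_le_right ?_
    have : ((z / 2 ^ n : ℤ) : ℝ) ≤ 2 * ((z / 2 ^ (n + 1) : ℤ) : ℝ) + 1 := by exact_mod_cast hhalf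
    linarith
  · refine le_max_of_le_left ?_
    have h4 : z / 2 ^ (n + 1) = 0 := by
      have h1 := Nat.lt_size_self z.toNat
      rw [show n + 1 = z.toNat.size by omega]
      refine Int.ediv_eq_zero_of_lt (by omega) ?_
      have : z < ((2 ^ z.toNat.size : ℕ) : ℤ) := by omega
      push_cast at this; exact this
    rw [h4] at hhalf
    exact_mod_cast hhalf

/-! ### The algorithm -/

/-- The data of an instance as lists: `μ`, `F`, `c` and `r`. -/
abbrev RawInstance := List ℚ × (List (List (List ℚ)) × (List (List ℚ) × List ℚ))

/-- The product of the denominators in a list. -/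
def denProd (l : List ℚ) : ℤ := (l.map fun q => (q.den : ℤ)).prod

/-- The numerator of `q` over the denominator `D`. -/
def scaled (D : ℤ) (q : ℚ) : ℤ := q.num * (D / q.den)

namespace RawInstance

/-- A common denominator of all data. -/
def commonDen (x : ℚ × RawInstance) : ℤ :=
  denProd x.2.1 * (denProd x.2.2.1.flatten.flatten * (denProd x.2.2.2.1.flatten * denProd x.2.2.2.2))

/-- The inverse of the weight with which the rewards enter the contracts. -/
def alignment (x : ℚ × RawInstance) : ℤ := 2 * x.1.den

/-- The number of outcomes. -/
def outcomes (x : ℚ × RawInstance) : ℤ := (x.2.2.2.2.map fun _ => (1 : ℤ)).sum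

/-- The number of subdivisions of every payment scale. -/
def resolution (x : ℚ × RawInstance) : ℤ := alignment x * alignment x * (1 + 4 * outcomes x)

/-- The common denominator of the payments. -/
def payDen (x : ℚ × RawInstance) : ℤ := alignment x * resolution x * commonDen x

/-- For every type its scaled probability and the list of its actions, each with scaled cost and
outcome distribution. -/
def types (x : ℚ × RawInstance) : List (ℤ × List (ℤ × List ℤ)) :=
  (x.2.1.map fun q => scaled (commonDen x) q).zip
    ((x.2.2.1.zip x.2.2.2.1).map fun y =>
      (y.2.map fun q => payDen x * scaled (commonDen x) q).zip
        (y.1.map fun f => f.map fun q => scaled (commonDen x) q))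

/-- The scaled rewards. -/
def rewards (x : ℚ × RawInstance) : List ℤ := x.2.2.2.2.map fun q => scaled (commonDen x) q

/-- The rewards over the denominator of the payments. -/
def payRewards (x : ℚ × RawInstance) : List ℤ :=
  (rewards x).map fun ρ => alignment x * resolution x * ρ

/-- The discretized payments. -/
def payments (x : ℚ × RawInstance) : List ℤ :=
  (halves (2 * commonDen x * commonDen x)).flatMap fun g =>
    (countdown (resolution x + 1)).map fun j => (alignment x - 1) * g * (j - 1) * commonDen x

/-- The discretized contracts, shifted towards the rewards. -/
def contracts (x : ℚ × RawInstance) : List (List ℤ) :=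
  ((rewards x).map fun ρ => (payments x).map fun q => q + resolution x * ρ).sections

/-- The grid for one vector of payment scales; its length bounds the number of contracts that have
to be put into a menu. -/
def grid (x : ℚ × RawInstance) : List (List ℤ) :=
  (x.2.2.2.2.map fun _ => countdown (resolution x + 1)).sections

/-- The sets of contracts that are tried. -/
def menus (x : ℚ × RawInstance) : List (List (List ℤ)) :=
  ((grid x).map fun _ => contracts x).sections

/-- The choice of a type with actions `acts`: its utility, the principal's utility and the
contract. -/
def response (R : List ℤ) (menu : List (List ℤ)) (acts : List (ℤ × List ℤ)) :
    ℤ × (ℤ × List ℤ) :=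
  argmax (0, (0, [])) (menu.flatMap fun p => acts.map fun a =>
    (dot a.2 p - a.1, (dot a.2 R - dot a.2 p, p)))

/-- The scaled value of a set of contracts, and the contracts chosen by the types. -/
def evaluate (R : List ℤ) (T : List (ℤ × List (ℤ × List ℤ))) (menu : List (List ℤ)) :
    ℤ × List (List ℤ) :=
  ((T.map fun t => t.1 * (response R menu t.2).2.1).sum, T.map fun t => (response R menu t.2).2.2)

/-- The best menu. -/
def solve (x : ℚ × RawInstance) : List (List (ℤ × ℤ)) :=
  (argmax (0, []) ((menus x).map fun M => evaluate (payRewards x) (types x) M)).2.map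
    fun p => p.map fun z => (z, payDen x)

end RawInstance

/-! ### Running time of the arithmetic and of the evaluation of one menu -/

namespace PolyOn

open RawInstance

variable {κ α : Type} [Enc α] {S : κ → Set α} {X : κ → Set (ℚ × RawInstance)}

theorem denProd {f : α → List ℚ} (hf : PolyOn S f) : PolyOn S (fun x => denProd (f x)) :=
  prod (map (f := fun y : α × ℚ => (y.2.den : ℤ)) hf id.snd.den)

theorem scaled {D : α → ℤ} {q : α → ℚ} (hD : PolyOn S D) (hq : PolyOn S q) :
    PolyOn S (fun x => scaled (D x) (q x)) :=
  mul hq.num (div hD hq.den)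

theorem commonDen : PolyOn X commonDen :=
  mul (denProd id.snd.fst) (mul (denProd id.snd.snd.fst.flatten.flatten)
    (mul (denProd id.snd.snd.snd.fst.flatten) (denProd id.snd.snd.snd.snd)))

theorem alignment : PolyOn X alignment := mul (const 2) id.fst.den

theorem outcomes : PolyOn X outcomes :=
  sum (map (f := fun _ => 1) id.snd.snd.snd.snd (const 1))

theorem resolution : PolyOn X resolution :=
  mul (mul alignment alignment) (add (const 1) (mul (const 4) outcomes))

theorem payDen : PolyOn X payDen := mul (mul alignment resolution) commonDen

theorem rewards : PolyOn X rewards :=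
  map (f := fun y : (ℚ × RawInstance) × ℚ => _root_.scaled (RawInstance.commonDen y.1) y.2)
    id.snd.snd.snd.snd (scaled (comp commonDen id.fst) id.snd)

theorem payRewards : PolyOn X payRewards :=
  map (f := fun y : (ℚ × RawInstance) × ℤ =>
      RawInstance.alignment y.1 * RawInstance.resolution y.1 * y.2)
    rewards (mul (mul (comp alignment id.fst) (comp resolution id.fst)) id.snd)

theorem types : PolyOn X types := by
  refine zip (map (f := fun y : (ℚ × RawInstance) × ℚ =>
    _root_.scaled (RawInstance.commonDen y.1) y.2) id.snd.fst
    (scaled (comp commonDen id.fst) id.snd)) ?_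
  refine map (f := fun w : (ℚ × RawInstance) × (List (List ℚ) × List ℚ) =>
    (w.2.2.map fun q => RawInstance.payDen w.1 * _root_.scaled (RawInstance.commonDen w.1) q).zip
      (w.2.1.map fun f => f.map fun q => _root_.scaled (RawInstance.commonDen w.1) q))
    (zip id.snd.snd.fst id.snd.snd.snd.fst) (zip ?_ ?_)
  · exact map (f := fun z : ((ℚ × RawInstance) × (List (List ℚ) × List ℚ)) × ℚ =>
      RawInstance.payDen z.1.1 * _root_.scaled (RawInstance.commonDen z.1.1) z.2) id.snd.snd
      (mul (comp payDen id.fst.fst) (scaled (comp commonDen id.fst.fst) id.snd))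
  · exact map (f := fun z : ((ℚ × RawInstance) × (List (List ℚ) × List ℚ)) × List ℚ =>
      z.2.map fun q => _root_.scaled (RawInstance.commonDen z.1.1) q) id.snd.fst
      (map (f := fun v : (((ℚ × RawInstance) × (List (List ℚ) × List ℚ)) × List ℚ) × ℚ =>
        _root_.scaled (RawInstance.commonDen v.1.1.1) v.2) id.snd
        (scaled (comp commonDen id.fst.fst.fst) id.snd))

theorem response {R : α → List ℤ} {M : α → List (List ℤ)} {acts : α → List (ℤ × List ℤ)}
    (hR : PolyOn S R) (hM : PolyOn S M) (ha : PolyOn S acts) :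
    PolyOn S (fun x => response (R x) (M x) (acts x)) := by
  refine comp (g := fun y : List ℤ × (List (List ℤ) × List (ℤ × List ℤ)) =>
    RawInstance.response y.1 y.2.1 y.2.2) (f := fun x => (R x, (M x, acts x))) ?_ (pair hR (pair hM ha))
  refine argmax (pair (const 0) (pair (const 0) nil)) ?_
  refine flatMap (f := fun z : (List ℤ × (List (List ℤ) × List (ℤ × List ℤ))) × List ℤ =>
    z.1.2.2.map fun a => (_root_.dot a.2 z.2 - a.1,
      (_root_.dot a.2 z.1.1 - _root_.dot a.2 z.2, z.2))) id.snd.fst ?_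
  refine map (f := fun w : ((List ℤ × (List (List ℤ) × List (ℤ × List ℤ))) × List ℤ) ×
    (ℤ × List ℤ) => (_root_.dot w.2.2 w.1.2 - w.2.1,
      (_root_.dot w.2.2 w.1.1.1 - _root_.dot w.2.2 w.1.2, w.1.2))) id.fst.snd.snd ?_
  exact pair (sub (dot id.snd.snd id.fst.snd) id.snd.fst)
    (pair (sub (dot id.snd.snd id.fst.fst.fst) (dot id.snd.snd id.fst.snd)) id.fst.snd)

theorem evaluate {R : α → List ℤ} {T : α → List (ℤ × List (ℤ × List ℤ))}
    {M : α → List (List ℤ)} (hR : PolyOn S R) (hT : PolyOn S T) (hM : PolyOn S M) :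
    PolyOn S (fun x => evaluate (R x) (T x) (M x)) := by
  refine comp (g := fun y : List ℤ × (List (ℤ × List (ℤ × List ℤ)) × List (List ℤ)) =>
    RawInstance.evaluate y.1 y.2.1 y.2.2) (f := fun x => (R x, (T x, M x))) ?_ (pair hR (pair hT hM))
  have h : PolyOn (extend fun _ : Unit => Set.univ)
      (fun z : (List ℤ × (List (ℤ × List (ℤ × List ℤ)) × List (List ℤ))) ×
        (ℤ × List (ℤ × List ℤ)) => RawInstance.response z.1.1 z.1.2.2 z.2.2) :=
    response id.fst.fst id.fst.snd.snd id.snd.snd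
  refine pair (sum ?_) ?_
  · exact map (f := fun z : (List ℤ × (List (ℤ × List (ℤ × List ℤ)) × List (List ℤ))) ×
      (ℤ × List (ℤ × List ℤ)) => z.2.1 * (RawInstance.response z.1.1 z.1.2.2 z.2.2).2.1)
      id.snd.fst (mul id.snd.fst h.snd.fst)
  · exact map (f := fun z : (List ℤ × (List (ℤ × List (ℤ × List ℤ)) × List (List ℤ))) ×
      (ℤ × List (ℤ × List ℤ)) => (RawInstance.response z.1.1 z.1.2.2 z.2.2).2.2)
      id.snd.fst h.snd.snd

end PolyOn

/-! ### Running time of the enumeration for fixed precision and number of outcomes -/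

namespace RawInstance

/-- The inputs with `k.1` outcomes and precision `k.2`. -/
def inputs (k : ℕ × ℚ) : Set (ℚ × RawInstance) := {x | x.1 = k.2 ∧ x.2.2.2.2.length = k.1}

theorem denProd_pos (l : List ℚ) : 0 < denProd l :=
  List.prod_pos fun z hz => by
    obtain ⟨q, -, rfl⟩ := List.mem_map.1 hz
    exact_mod_cast q.den_pos

theorem commonDen_pos (x : ℚ × RawInstance) : 0 < commonDen x :=
  mul_pos (denProd_pos _) (mul_pos (denProd_pos _) (mul_pos (denProd_pos _) (denProd_pos _)))

theorem outcomes_eq (x : ℚ × RawInstance) : outcomes x = x.2.2.2.2.length := by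
  simp [outcomes]

theorem alignment_pos (x : ℚ × RawInstance) : 2 ≤ alignment x := by
  have := x.1.den_pos
  unfold alignment
  omega

theorem resolution_pos (x : ℚ × RawInstance) : 0 < resolution x := by
  have h1 := alignment_pos x
  unfold resolution
  rw [outcomes_eq]
  positivity

theorem length_sections_replicate {β : Type} (n : ℕ) (l : List β) :
    (List.replicate n l).sections.length = l.length ^ n := by
  induction n with
  | zero => rfl
  | succ n ih =>
    rw [List.replicate_succ, List.sections, List.length_flatMap]
    simp [ih, pow_succ]

theorem length_grid (x : ℚ × RawInstance) :
    (grid x).length = (resolution x + 1).toNat ^ x.2.2.2.2.length := by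
  rw [grid, List.map_const', length_sections_replicate, length_countdown]

end RawInstance

namespace PolyOn

open RawInstance

/-- The resolution depends only on the denominator of `δ` and on `m`, so it is constant on each set
`inputs k`. -/
theorem countdown_resolution : PolyOn inputs (fun x => _root_.countdown (RawInstance.resolution x + 1)) := by
  refine countdown (add resolution (const 1)) fun k =>
    ⟨((2 * (k.2.den : ℤ)) * (2 * k.2.den) * (1 + 4 * k.1) + 1).toNat, ?_⟩
  rintro x ⟨h1, h2⟩
  have h := resolution_pos x
  have : RawInstance.resolution x = (2 * (k.2.den : ℤ)) * (2 * k.2.den) * (1 + 4 * k.1) := by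
    rw [RawInstance.resolution, RawInstance.alignment, outcomes_eq, h1, h2]
  rw [← this]
  omega

theorem payments : PolyOn inputs payments := by
  refine flatMap (f := fun y : (ℚ × RawInstance) × ℤ =>
    (_root_.countdown (RawInstance.resolution y.1 + 1)).map fun j =>
      (RawInstance.alignment y.1 - 1) * y.2 * (j - 1) * RawInstance.commonDen y.1)
    (halves (mul (mul (const 2) commonDen) commonDen) ?_) ?_
  · intro k x _
    have := commonDen_pos x
    positivity
  · refine map (f := fun z : ((ℚ × RawInstance) × ℤ) × ℤ =>
      (RawInstance.alignment z.1.1 - 1) * z.1.2 * (z.2 - 1) * RawInstance.commonDen z.1.1)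
      (comp_of (g := fun x => _root_.countdown (RawInstance.resolution x + 1))
        countdown_resolution id.fst fun k => ⟨k, fun x hx => hx⟩) ?_
    exact mul (mul (mul (sub (comp alignment id.fst.fst) (const 1)) id.fst.snd)
      (sub id.snd (const 1))) (comp commonDen id.fst.fst)

theorem contracts : PolyOn inputs contracts := by
  refine sections (map (f := fun y : (ℚ × RawInstance) × ℤ =>
    (RawInstance.payments y.1).map fun q => q + RawInstance.resolution y.1 * y.2) rewards ?_)
    fun k => ⟨k.1, fun x hx => ?_⟩
  · exact map (f := fun z : ((ℚ × RawInstance) × ℤ) × ℤ =>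
      z.2 + RawInstance.resolution z.1.1 * z.1.2)
      (comp_of payments id.fst fun k => ⟨k, fun x hx => hx⟩)
      (add id.snd (mul (comp resolution id.fst.fst) id.fst.snd))
  · simp [RawInstance.rewards, hx.2]

theorem grid : PolyOn inputs grid := by
  refine sections (map (f := fun y : (ℚ × RawInstance) × ℚ =>
    _root_.countdown (RawInstance.resolution y.1 + 1)) id.snd.snd.snd.snd
    (comp_of (g := fun x => _root_.countdown (RawInstance.resolution x + 1))
        countdown_resolution id.fst fun k => ⟨k, fun x hx => hx⟩))
    fun k => ⟨k.1, fun x hx => ?_⟩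
  simp [hx.2]

/-- A menu has `(N+1)^m` entries, a constant on `inputs k`, so the power of the polynomially long
list of contracts remains polynomial. -/
theorem menus : PolyOn inputs menus := by
  refine sections (map (f := fun y : (ℚ × RawInstance) × List ℤ => RawInstance.contracts y.1) grid
    (comp_of contracts id.fst fun k => ⟨k, fun x hx => hx⟩))
    fun k => ⟨((2 * (k.2.den : ℤ)) * (2 * k.2.den) * (1 + 4 * k.1) + 1).toNat ^ k.1, ?_⟩
  rintro x ⟨h1, h2⟩
  rw [List.length_map, length_grid, RawInstance.resolution, RawInstance.alignment, outcomes_eq,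
    h1, h2]

theorem solve : PolyOn inputs solve := by
  refine map (f := fun y : (ℚ × RawInstance) × List ℤ => y.2.map fun z =>
    (z, RawInstance.payDen y.1)) (snd (argmax (pair (const 0) nil) ?_)) ?_
  · exact map (f := fun y : (ℚ × RawInstance) × List (List ℤ) =>
      RawInstance.evaluate (RawInstance.payRewards y.1) (RawInstance.types y.1) y.2) menus
      (evaluate (comp payRewards id.fst) (comp types id.fst) id.snd)
  · exact map (f := fun z : ((ℚ × RawInstance) × List ℤ) × ℤ =>
      (z.2, RawInstance.payDen z.1.1)) id.snd (pair id.snd (comp payDen id.fst.fst))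

end PolyOn

/-! ### Rounding of menus -/

namespace PAInstance

variable {ℓ n m : ℕ} (I : PAInstance ℓ n m)

theorem agentUtility_le_bestResponse (θ : Fin ℓ) (a : Fin n) (p : Fin m → ℝ) :
    I.agentUtility θ a p ≤ I.agentUtility θ (I.bestResponse θ p) p :=
  (I.exists_bestResponse θ p).choose_spec.1 a

theorem principalUtility_le_bestResponse {θ : Fin ℓ} {a : Fin n} {p : Fin m → ℝ}
    (h : a ∈ I.bestResponses θ p) :
    I.principalUtility θ a p ≤ I.principalUtility θ (I.bestResponse θ p) p :=
  (I.exists_bestResponse θ p).choose_spec.2 a h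

theorem sum_F_mul_r_nonneg (θ : Fin ℓ) (a : Fin n) :
    (0 : ℝ) ≤ ∑ ω, (I.F θ a ω : ℝ) * (I.r ω : ℝ) :=
  Finset.sum_nonneg fun ω _ => mul_nonneg (by exact_mod_cast I.F_nonneg θ a ω)
    (by exact_mod_cast I.r_nonneg ω)

theorem sum_F (θ : Fin ℓ) (a : Fin n) : ∑ ω, (I.F θ a ω : ℝ) = 1 := by
  exact_mod_cast I.F_sum θ a

theorem sum_F_mul_r_le_one (θ : Fin ℓ) (a : Fin n) :
    ∑ ω, (I.F θ a ω : ℝ) * (I.r ω : ℝ) ≤ 1 := by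
  rw [← I.sum_F θ a]
  refine Finset.sum_le_sum fun ω _ => mul_le_of_le_one_right ?_ ?_
  · exact_mod_cast I.F_nonneg θ a ω
  · exact_mod_cast I.r_le_one ω

theorem zero_isDSIC : I.IsDSIC fun _ _ => 0 :=
  ⟨fun _ _ => le_rfl, fun _ _ _ => le_rfl⟩

/-- The zero menu serves as the competitor in place of menus of negative value, to which the
rounding does not apply. -/
theorem menuUtility_zero_nonneg : 0 ≤ I.menuUtility fun _ _ => 0 := by
  refine Finset.sum_nonneg fun θ _ => mul_nonneg (by exact_mod_cast I.μ_nonneg θ) ?_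
  simpa [principalUtility] using I.sum_F_mul_r_nonneg _ _

theorem agentUtility_bestResponse_nonneg (θ : Fin ℓ) {p : Fin m → ℝ} (hp : ∀ ω, 0 ≤ p ω) :
    0 ≤ I.agentUtility θ (I.bestResponse θ p) p := by
  obtain ⟨a, ha⟩ := I.exists_free
  refine le_trans ?_ (I.agentUtility_le_bestResponse θ a p)
  rw [agentUtility, ha θ]
  simpa using Finset.sum_nonneg fun ω _ =>
    mul_nonneg (show (0 : ℝ) ≤ I.F θ a ω by exact_mod_cast I.F_nonneg θ a ω) (hp ω)

variable {I}

theorem IsDSIC.agentUtility_le {P : Fin ℓ → Fin m → ℝ} (hP : I.IsDSIC P) (θ θ' : Fin ℓ)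
    (a : Fin n) :
    I.agentUtility θ a (P θ') ≤ I.agentUtility θ (I.bestResponse θ (P θ)) (P θ) := by
  refine (I.agentUtility_le_bestResponse θ a (P θ')).trans ?_
  by_cases h : θ' = θ
  · rw [h]
  · exact hP.2 θ θ' h

/-- The agents' total utility is at most one unless the principal loses. -/
theorem sum_agentUtility_le_one {P : Fin ℓ → Fin m → ℝ} (h0 : 0 ≤ I.menuUtility P) :
    ∑ θ, (I.μ θ : ℝ) * I.agentUtility θ (I.bestResponse θ (P θ)) (P θ) ≤ 1 := by
  have h1 : ∑ θ, (I.μ θ : ℝ) = 1 := by exact_mod_cast I.μ_sum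
  -- Payments cancel: the two utilities add up to expected reward minus cost, which is at most one.
  have h2 : ∑ θ, (I.μ θ : ℝ) * I.agentUtility θ (I.bestResponse θ (P θ)) (P θ) +
      I.menuUtility P ≤ 1 := by
    rw [menuUtility, ← Finset.sum_add_distrib]
    refine (Finset.sum_le_sum fun θ _ => ?_).trans h1.le
    rw [← mul_add]
    refine mul_le_of_le_one_right (by exact_mod_cast I.μ_nonneg θ) ?_
    have h3 := I.sum_F_mul_r_le_one θ (I.bestResponse θ (P θ))
    have h4 : (0 : ℝ) ≤ I.c θ (I.bestResponse θ (P θ)) := by exact_mod_cast I.c_nonneg _ _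
    rw [agentUtility, principalUtility]
    linarith
  linarith

/-- Every DSIC menu can be rounded to a grid with few scales such that, after a shift towards the
rewards, any choice of most preferred contracts and actions is almost as good for the principal. -/
theorem IsDSIC.exists_rounding {P : Fin ℓ → Fin m → ℝ} (hP : I.IsDSIC P)
    (h0 : 0 ≤ I.menuUtility P) {D N A : ℤ} (hD : 1 ≤ D) (hN : 1 ≤ N) (hA : 1 ≤ A)
    (hμ : ∀ θ, 0 < I.μ θ → 1 ≤ (D : ℝ) * I.μ θ)
    (hF : ∀ θ a ω, 0 < I.F θ a ω → 1 ≤ (D : ℝ) * I.F θ a ω) :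
    ∃ g : Fin m → ℤ, (∀ ω, g ω ∈ halves (2 * D * D)) ∧ ∃ j : Fin ℓ → Fin m → ℤ,
      (∀ θ ω, 0 ≤ j θ ω ∧ j θ ω ≤ N) ∧ ∃ s : Fin ℓ → Fin m → ℝ,
      (∀ θ ω, s θ ω = (1 - 1 / (A : ℝ)) * ((g ω : ℝ) * j θ ω / N) + 1 / (A : ℝ) * I.r ω) ∧
      ∀ (Q : Fin ℓ → Fin m → ℝ) (b : Fin ℓ → Fin n), (∀ θ, ∃ θ', Q θ = s θ') →
        (∀ θ θ' a, I.agentUtility θ a (s θ') ≤ I.agentUtility θ (b θ) (Q θ)) →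
        I.menuUtility P - (1 / (A : ℝ) + A * (4 * m + 1) / N) ≤
          ∑ θ, (I.μ θ : ℝ) * I.principalUtility θ (b θ) (Q θ) := by
  classical
  have hDr : (1 : ℝ) ≤ D := by exact_mod_cast hD
  have hNr : (1 : ℝ) ≤ N := by exact_mod_cast hN
  have hAr : (1 : ℝ) ≤ A := by exact_mod_cast hA
  have hμ0 : ∀ θ, (0 : ℝ) ≤ I.μ θ := fun θ => by exact_mod_cast I.μ_nonneg θ
  have hμ1 : ∑ θ, (I.μ θ : ℝ) = 1 := by exact_mod_cast I.μ_sum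
  have hF0 : ∀ θ a ω, (0 : ℝ) ≤ I.F θ a ω := fun θ a ω => by exact_mod_cast I.F_nonneg θ a ω
  set act : Fin ℓ → Fin n := fun θ => I.bestResponse θ (P θ) with hact
  set u : Fin ℓ → ℝ := fun θ => I.agentUtility θ (act θ) (P θ) with hu
  have hbest : ∀ θ θ' a, I.agentUtility θ a (P θ') ≤ u θ := fun θ θ' a => hP.agentUtility_le θ θ' a
  have hu0 : ∀ θ, 0 ≤ u θ := fun θ => I.agentUtility_bestResponse_nonneg θ (hP.1 θ)
  have husum : ∑ θ, (I.μ θ : ℝ) * u θ ≤ 1 := sum_agentUtility_le_one h0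
  have hu1 : ∀ θ, (I.μ θ : ℝ) * u θ ≤ 1 := fun θ =>
    (Finset.single_le_sum (f := fun θ => (I.μ θ : ℝ) * u θ)
      (fun θ _ => mul_nonneg (hμ0 θ) (hu0 θ)) (Finset.mem_univ θ)).trans husum
  have hne : Nonempty (Fin ℓ) := by
    by_contra h
    rw [not_nonempty_iff] at h
    simp at hμ1
  choose top htop using fun ω => Finite.exists_max fun θ => P θ ω
  set M : Fin m → ℝ := fun ω => P (top ω) ω with hM
  have hM0 : ∀ ω, 0 ≤ M ω := fun ω => hP.1 _ _
  -- Type `θ` could report `top ω` and play `a`, at a cost of at most one.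
  have hFM : ∀ θ a ω, (I.F θ a ω : ℝ) * M ω ≤ u θ + 1 := by
    intro θ a ω
    have h1 := hbest θ (top ω) a
    have h2 : (I.F θ a ω : ℝ) * M ω ≤ ∑ ω', (I.F θ a ω' : ℝ) * P (top ω) ω' :=
      Finset.single_le_sum (f := fun ω' => (I.F θ a ω' : ℝ) * P (top ω) ω')
        (fun ω' _ => mul_nonneg (hF0 _ _ _) (hP.1 _ _)) (Finset.mem_univ ω)
    have h3 : (I.c θ a : ℝ) ≤ 1 := by exact_mod_cast I.c_le_one θ a
    rw [agentUtility] at h1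
    linarith
  -- Payments for other outcomes are not bounded by `hFM` in a useful way, but they do not affect
  -- any type of positive probability; they are rounded to zero.
  let Rel : Fin m → Prop := fun ω => ∃ θ a, 0 < I.μ θ ∧ 0 < I.F θ a ω
  -- Positive `μ θ` and `F θ a ω` are at least `1 / D`, so `u θ ≤ D` and `M ω ≤ D * (D + 1)`.
  have hMle : ∀ ω, Rel ω → M ω ≤ ((2 * D * D : ℤ) : ℝ) := by
    rintro ω ⟨θ, a, h1, h2⟩
    have h3 := hμ θ h1
    have h4 := hF θ a ω h2
    have h5 : u θ ≤ D := by
      have := hu1 θ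
      nlinarith [hu0 θ, mul_le_mul_of_nonneg_left this (zero_le_one.trans hDr)]
    have h6 := hFM θ a ω
    have h7 : M ω ≤ D * (u θ + 1) := by
      nlinarith [hM0 ω, mul_le_mul_of_nonneg_left h6 (zero_le_one.trans hDr)]
    push_cast
    nlinarith
  have hg : ∀ ω, ∃ g ∈ halves (2 * D * D), 1 ≤ g ∧ (Rel ω → M ω ≤ g ∧ (g : ℝ) ≤ 2 * M ω + 1) := by
    intro ω
    have hz : 1 ≤ 2 * D * D := by nlinarith
    by_cases h : Rel ω
    · obtain ⟨g, h1, h2, h3, h4⟩ := exists_mem_halves hz (hMle ω h)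
      rw [max_eq_right (by linarith [hM0 ω])] at h4
      exact ⟨g, h1, h2, fun _ => ⟨h3, h4⟩⟩
    · obtain ⟨g, h1, h2, -⟩ := exists_mem_halves (x := 0) hz
        (by exact_mod_cast zero_le_one.trans hz)
      exact ⟨g, h1, h2, fun h' => absurd h' h⟩
  choose g hgmem hg1 hgM using hg
  have hg1r : ∀ ω, (1 : ℝ) ≤ g ω := fun ω => by exact_mod_cast hg1 ω
  let j : Fin ℓ → Fin m → ℤ := fun θ ω => if Rel ω then ⌊P θ ω * N / g ω⌋ else 0
  let p : Fin ℓ → Fin m → ℝ := fun θ ω => (g ω : ℝ) * j θ ω / N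
  let s : Fin ℓ → Fin m → ℝ := fun θ ω => (1 - 1 / (A : ℝ)) * p θ ω + 1 / (A : ℝ) * I.r ω
  have hp : ∀ θ ω, Rel ω → p θ ω ≤ P θ ω ∧ P θ ω ≤ p θ ω + g ω / N := by
    intro θ ω h
    have hgp : (0 : ℝ) < g ω := zero_lt_one.trans_le (hg1r ω)
    have hNp : (0 : ℝ) < N := zero_lt_one.trans_le hNr
    have h1 : (j θ ω : ℝ) ≤ P θ ω * N / g ω := by simp only [j, h, if_true]; exact Int.floor_le _
    have h2 : P θ ω * N / g ω ≤ j θ ω + 1 := by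
      simp only [j, h, if_true]; exact (Int.lt_floor_add_one _).le
    rw [le_div_iff₀ hgp] at h1
    rw [div_le_iff₀ hgp] at h2
    constructor
    · simp only [p]; rw [div_le_iff₀ hNp]; linarith
    · simp only [p]; rw [← add_div, le_div_iff₀ hNp]; linarith
  -- The rounding error at `ω` is at most `F * g / N ≤ F * (2 * M + 1) / N ≤ (2 * (u + 1) + F) / N`;
  -- summing over the outcomes gives `η`.
  set η : Fin ℓ → ℝ := fun θ => (2 * m * (u θ + 1) + 1) / N with hη
  have hlow : ∀ θ, 0 < I.μ θ → ∀ θ' a,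
      ∑ ω, (I.F θ a ω : ℝ) * p θ' ω ≤ ∑ ω, (I.F θ a ω : ℝ) * P θ' ω := by
    intro θ hθ θ' a
    refine Finset.sum_le_sum fun ω _ => ?_
    rcases (I.F_nonneg θ a ω).eq_or_lt with h | h
    · rw [← h]; simp
    · exact mul_le_mul_of_nonneg_left (hp θ' ω ⟨θ, a, hθ, h⟩).1 (hF0 _ _ _)
  have hhigh : ∀ θ, 0 < I.μ θ → ∀ θ' a,
      ∑ ω, (I.F θ a ω : ℝ) * P θ' ω ≤ ∑ ω, (I.F θ a ω : ℝ) * p θ' ω + η θ := by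
    intro θ hθ θ' a
    have h1 : η θ = ∑ ω, (2 * (u θ + 1) + I.F θ a ω) / N := by
      rw [← Finset.sum_div, Finset.sum_add_distrib, I.sum_F, Finset.sum_const, Finset.card_univ,
        Fintype.card_fin, nsmul_eq_mul, hη]
      ring
    rw [h1, ← Finset.sum_add_distrib]
    refine Finset.sum_le_sum fun ω _ => ?_
    have hNp : (0 : ℝ) < N := zero_lt_one.trans_le hNr
    rcases (I.F_nonneg θ a ω).eq_or_lt with h | h
    · rw [← h]
      have := hu0 θ
      simp only [Rat.cast_zero, zero_mul, zero_add, add_zero]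
      positivity
    · have hrel : Rel ω := ⟨θ, a, hθ, h⟩
      have h2 := (hp θ' ω hrel).2
      have h3 := (hgM ω hrel).2
      have h4 := hFM θ a ω
      have h5 : (I.F θ a ω : ℝ) * (g ω / N) ≤ (2 * (u θ + 1) + I.F θ a ω) / N := by
        rw [← mul_div_assoc]
        gcongr
        nlinarith [hF0 θ a ω, mul_le_mul_of_nonneg_left h3 (hF0 θ a ω)]
      nlinarith [mul_le_mul_of_nonneg_left h2 (hF0 θ a ω)]
  refine ⟨g, hgmem, j, ?_, s, fun _ _ => rfl, ?_⟩
  · intro θ ω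
    by_cases h : Rel ω
    · have hgp : (0 : ℝ) < g ω := zero_lt_one.trans_le (hg1r ω)
      simp only [j, h, if_true]
      constructor
      · refine Int.floor_nonneg.2 (div_nonneg (mul_nonneg (hP.1 _ _) (by linarith)) hgp.le)
      · refine Int.cast_le.1 ((Int.floor_le _).trans ?_ : ((_ : ℤ) : ℝ) ≤ N)
        rw [div_le_iff₀ hgp]
        nlinarith [htop ω θ, (hgM ω h).1]
    · simp only [j, h, if_false]; omega
  · intro Q b hQ hb
    have hα0 : 0 < 1 / (A : ℝ) := by positivity
    have hα1 : 1 / (A : ℝ) ≤ 1 := by rw [div_le_one (by linarith)]; exact hAr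
    have hsum : ∀ θ θ' a, ∑ ω, (I.F θ a ω : ℝ) * s θ' ω =
        (1 - 1 / (A : ℝ)) * ∑ ω, (I.F θ a ω : ℝ) * p θ' ω +
          1 / (A : ℝ) * ∑ ω, (I.F θ a ω : ℝ) * I.r ω := by
      intro θ θ' a
      rw [Finset.mul_sum, Finset.mul_sum, ← Finset.sum_add_distrib]
      refine Finset.sum_congr rfl fun ω _ => ?_
      simp only [s]; ring
    have key : ∀ θ, (I.μ θ : ℝ) *
        ((1 - 1 / (A : ℝ)) * (I.principalUtility θ (act θ) (P θ) - A * η θ)) ≤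
        (I.μ θ : ℝ) * I.principalUtility θ (b θ) (Q θ) := by
      intro θ
      rcases (I.μ_nonneg θ).eq_or_lt with h | h
      · rw [← h]; simp
      refine mul_le_mul_of_nonneg_left ?_ (hμ0 θ)
      obtain ⟨θ', hθ'⟩ := hQ θ
      have h1 := hb θ θ (act θ)
      have h2 := hbest θ θ' (b θ)
      have h3 := hlow θ h θ' (b θ)
      have h4 := hlow θ h θ (act θ)
      have h5 := hhigh θ h θ (act θ)
      rw [hθ'] at h1 ⊢
      simp only [hu, agentUtility, principalUtility, hsum] at h1 h2 ⊢
      set α := 1 / (A : ℝ) with hα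
      have hαA : (A : ℝ) * α = 1 := by rw [hα]; field_simp
      -- By `h2`, `h3` and `h5`, under the unshifted rounded contracts the pair `(θ', b θ)` beats
      -- `(θ, act θ)` by at most `η θ`. Its being preferred under the shifted ones (`h1`) then
      -- bounds the principal's loss, weighted by `α`.
      have h6 : -(η θ) ≤ α *
          ((∑ ω, (I.F θ (b θ) ω : ℝ) * I.r ω - ∑ ω, (I.F θ (b θ) ω : ℝ) * p θ' ω) -
          (∑ ω, (I.F θ (act θ) ω : ℝ) * I.r ω - ∑ ω, (I.F θ (act θ) ω : ℝ) * p θ ω)) := by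
        linarith
      have h7 : -(A * η θ) ≤
          ((∑ ω, (I.F θ (b θ) ω : ℝ) * I.r ω - ∑ ω, (I.F θ (b θ) ω : ℝ) * p θ' ω) -
          (∑ ω, (I.F θ (act θ) ω : ℝ) * I.r ω - ∑ ω, (I.F θ (act θ) ω : ℝ) * p θ ω)) := by
        have := mul_le_mul_of_nonneg_left h6 (zero_le_one.trans hAr)
        rw [← mul_assoc, hαA] at this
        linarith
      have h8 : ∑ ω, (I.F θ (act θ) ω : ℝ) * I.r ω - ∑ ω, (I.F θ (act θ) ω : ℝ) * P θ ω - A * η θ ≤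
          ∑ ω, (I.F θ (b θ) ω : ℝ) * I.r ω - ∑ ω, (I.F θ (b θ) ω : ℝ) * p θ' ω := by
        linarith
      -- Under a shifted contract the principal's utility is exactly `1 - α` times that under the
      -- unshifted one.
      have := mul_le_mul_of_nonneg_left h8 (sub_nonneg.2 hα1)
      linarith
    refine le_trans ?_ (Finset.sum_le_sum fun θ _ => key θ)
    -- This turns the factor `1 - 1 / A` into an additive loss of at most `1 / A`.
    have hV : I.menuUtility P ≤ 1 := by
      rw [menuUtility, ← hμ1]
      refine Finset.sum_le_sum fun θ _ => mul_le_of_le_one_right (hμ0 θ) ?_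
      have h1 := I.sum_F_mul_r_le_one θ (I.bestResponse θ (P θ))
      have h2 : 0 ≤ ∑ ω, (I.F θ (I.bestResponse θ (P θ)) ω : ℝ) * P θ ω :=
        Finset.sum_nonneg fun ω _ => mul_nonneg (hF0 _ _ _) (hP.1 _ _)
      rw [principalUtility]; linarith
    have h1 : ∑ θ, (I.μ θ : ℝ) *
        ((1 - 1 / (A : ℝ)) * (I.principalUtility θ (act θ) (P θ) - A * η θ)) =
        (1 - 1 / (A : ℝ)) * (I.menuUtility P - A * ∑ θ, (I.μ θ : ℝ) * η θ) := by
      rw [menuUtility, Finset.mul_sum, ← Finset.sum_sub_distrib, Finset.mul_sum]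
      refine Finset.sum_congr rfl fun θ _ => ?_
      ring
    have h2 : ∑ θ, (I.μ θ : ℝ) * η θ ≤ (4 * m + 1) / N := by
      have : ∑ θ, (I.μ θ : ℝ) * η θ =
          (2 * m * ∑ θ, (I.μ θ : ℝ) * u θ + (2 * m + 1) * ∑ θ, (I.μ θ : ℝ)) / N := by
        rw [Finset.mul_sum, Finset.mul_sum, ← Finset.sum_add_distrib, Finset.sum_div]
        refine Finset.sum_congr rfl fun θ _ => ?_
        simp only [hη]; ring
      rw [this, hμ1]
      have hm : (0 : ℝ) ≤ m := Nat.cast_nonneg m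
      refine div_le_div_of_nonneg_right ?_ (by linarith)
      nlinarith [mul_le_mul_of_nonneg_left husum hm]
    have h3 : (A : ℝ) * ∑ θ, (I.μ θ : ℝ) * η θ ≤ A * (4 * m + 1) / N := by
      rw [mul_div_assoc]; gcongr
    have h4 : 0 ≤ (A : ℝ) * (4 * m + 1) / N := by positivity
    rw [h1]
    have h5 : I.menuUtility P - (A : ℝ) * (4 * m + 1) / N ≤
        I.menuUtility P - A * ∑ θ, (I.μ θ : ℝ) * η θ := by linarith
    have h6 := mul_le_mul_of_nonneg_left h5 (sub_nonneg.2 hα1)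
    refine le_trans ?_ h6
    nlinarith

end PAInstance

/-! ### Correctness of the algorithm -/

theorem List.zip_ofFn {β γ : Type} {k : ℕ} (f : Fin k → β) (g : Fin k → γ) :
    (List.ofFn f).zip (List.ofFn g) = List.ofFn fun i => (f i, g i) := by
  apply List.ext_getElem <;> simp

theorem List.forall₂_ofFn {β γ : Type} {R : β → γ → Prop} {k : ℕ} {v : List β} {L : Fin k → γ} :
    List.Forall₂ R v (List.ofFn L) ↔ ∃ f : Fin k → β, v = List.ofFn f ∧ ∀ i, R (f i) (L i) := by
  rw [List.forall₂_iff_get]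
  constructor
  · rintro ⟨h1, h2⟩
    rw [List.length_ofFn] at h1
    subst h1
    refine ⟨v.get, (List.ofFn_get v).symm, fun i => ?_⟩
    simpa using h2 i i.2 (by simp)
  · rintro ⟨f, rfl, h⟩
    exact ⟨by simp, fun i h1 h2 => by simpa using h ⟨i, by simpa using h1⟩⟩

theorem List.forall₂_replicate {β γ : Type} {R : β → γ → Prop} {k : ℕ} {v : List β} {c : γ} :
    List.Forall₂ R v (List.replicate k c) ↔ v.length = k ∧ ∀ b ∈ v, R b c := by
  rw [← List.ofFn_const, List.forall₂_ofFn]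
  constructor
  · rintro ⟨f, rfl, h⟩
    exact ⟨by simp, fun b hb => by obtain ⟨i, rfl⟩ := (List.mem_ofFn' _ _).1 hb; exact h i⟩
  · rintro ⟨rfl, h⟩
    exact ⟨v.get, (List.ofFn_get v).symm, fun i => h _ (List.get_mem _ _)⟩

theorem dot_ofFn {k : ℕ} (f g : Fin k → ℤ) : dot (List.ofFn f) (List.ofFn g) = ∑ i, f i * g i := by
  simp [dot, List.zip_ofFn, List.map_ofFn, List.sum_ofFn]

theorem den_dvd_denProd {l : List ℚ} {q : ℚ} (h : q ∈ l) : (q.den : ℤ) ∣ denProd l :=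
  List.dvd_prod (List.mem_map.2 ⟨q, h, rfl⟩)

theorem cast_scaled {D : ℤ} {q : ℚ} (h : (q.den : ℤ) ∣ D) : (scaled D q : ℝ) = D * q := by
  obtain ⟨e, rfl⟩ := h
  have h1 : (q.den : ℤ) ≠ 0 := by exact_mod_cast q.den_nz
  have h2 : (q.den : ℝ) ≠ 0 := by exact_mod_cast q.den_nz
  rw [scaled, Int.mul_ediv_cancel_left _ h1]
  push_cast
  rw [Rat.cast_def]
  field_simp

theorem Enc.enc_ofFn {β : Type} [Enc β] {k : ℕ} (f : Fin k → β) :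
    Enc.enc (List.ofFn f) = Data.ofTuple fun i => Enc.enc (f i) := by
  simp only [Enc.enc, Data.ofTuple, List.map_ofFn]
  rfl

namespace PAInstance

open RawInstance

variable {ℓ n m : ℕ} (I : PAInstance ℓ n m) (δ : ℚ)

/-- The data of an instance as lists. -/
def toRaw : RawInstance :=
  (List.ofFn I.μ, (List.ofFn fun θ => List.ofFn fun a => List.ofFn (I.F θ a),
    (List.ofFn fun θ => List.ofFn (I.c θ), List.ofFn I.r)))

theorem enc_toRaw : Enc.enc I.toRaw = I.toData := by
  have h : ∀ (β γ : Type) [Enc β] [Enc γ] (x : β) (y : γ),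
    Enc.enc (x, y) = Data.pair (Enc.enc x) (Enc.enc y) := fun _ _ _ _ _ _ => rfl
  simp only [toRaw, h, Enc.enc_ofFn]
  rfl

theorem den_μ_dvd (θ : Fin ℓ) : ((I.μ θ).den : ℤ) ∣ commonDen (δ, I.toRaw) :=
  Dvd.dvd.mul_right (den_dvd_denProd (by simp [toRaw])) _

theorem den_F_dvd (θ : Fin ℓ) (a : Fin n) (ω : Fin m) :
    ((I.F θ a ω).den : ℤ) ∣ commonDen (δ, I.toRaw) := by
  refine Dvd.dvd.mul_left (Dvd.dvd.mul_right (den_dvd_denProd ?_) _) _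
  simp only [toRaw, List.mem_flatten]
  exact ⟨List.ofFn (I.F θ a), ⟨List.ofFn fun a => List.ofFn (I.F θ a), by simp, by simp⟩, by simp⟩

theorem den_c_dvd (θ : Fin ℓ) (a : Fin n) : ((I.c θ a).den : ℤ) ∣ commonDen (δ, I.toRaw) := by
  refine Dvd.dvd.mul_left (Dvd.dvd.mul_left (Dvd.dvd.mul_right (den_dvd_denProd ?_) _) _) _
  simp only [toRaw, List.mem_flatten]
  exact ⟨List.ofFn (I.c θ), by simp, by simp⟩

theorem den_r_dvd (ω : Fin m) : ((I.r ω).den : ℤ) ∣ commonDen (δ, I.toRaw) :=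
  Dvd.dvd.mul_left (Dvd.dvd.mul_left (Dvd.dvd.mul_left (den_dvd_denProd (by simp [toRaw])) _) _) _

theorem types_toRaw : types (δ, I.toRaw) = List.ofFn fun θ =>
    (scaled (commonDen (δ, I.toRaw)) (I.μ θ), List.ofFn fun a =>
      (payDen (δ, I.toRaw) * scaled (commonDen (δ, I.toRaw)) (I.c θ a),
        List.ofFn fun ω => scaled (commonDen (δ, I.toRaw)) (I.F θ a ω))) := by
  generalize hD : commonDen (δ, I.toRaw) = D
  generalize hE : payDen (δ, I.toRaw) = E
  simp only [types, hD, hE]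
  simp only [toRaw, List.map_ofFn, List.zip_ofFn, Function.comp_def]

theorem rewards_toRaw : rewards (δ, I.toRaw) =
    List.ofFn fun ω => scaled (commonDen (δ, I.toRaw)) (I.r ω) := by
  generalize hD : commonDen (δ, I.toRaw) = D
  simp only [rewards, hD]
  simp only [toRaw, List.map_ofFn, Function.comp_def]

theorem payRewards_toRaw : payRewards (δ, I.toRaw) = List.ofFn fun ω =>
    alignment (δ, I.toRaw) * resolution (δ, I.toRaw) *
      scaled (commonDen (δ, I.toRaw)) (I.r ω) := by
  rw [payRewards, rewards_toRaw, List.map_ofFn]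
  rfl

/-- The contract with the given numerators. -/
noncomputable def contractOf (p : Fin m → ℤ) (ω : Fin m) : ℝ :=
  (p ω : ℝ) / (payDen (δ, I.toRaw) : ℝ)

theorem payDen_pos : 0 < payDen (δ, I.toRaw) :=
  mul_pos (mul_pos (zero_lt_two.trans_le (alignment_pos _)) (resolution_pos _)) (commonDen_pos _)

/-- Probabilities are scaled by `commonDen` and payments by `payDen`; the extra factor `payDen` on
the costs puts both terms on the same scale. -/
theorem scaled_agentUtility (θ : Fin ℓ) (a : Fin n) (p : Fin m → ℤ) :
    ((dot (List.ofFn fun ω => scaled (commonDen (δ, I.toRaw)) (I.F θ a ω)) (List.ofFn p) -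
      payDen (δ, I.toRaw) * scaled (commonDen (δ, I.toRaw)) (I.c θ a) : ℤ) : ℝ) =
    commonDen (δ, I.toRaw) * payDen (δ, I.toRaw) * I.agentUtility θ a (I.contractOf δ p) := by
  have hE : (payDen (δ, I.toRaw) : ℝ) ≠ 0 := by exact_mod_cast (I.payDen_pos δ).ne'
  rw [dot_ofFn, agentUtility, mul_sub, Finset.mul_sum]
  push_cast
  rw [cast_scaled (I.den_c_dvd δ θ a)]
  congr 1
  · refine Finset.sum_congr rfl fun ω _ => ?_
    rw [cast_scaled (I.den_F_dvd δ θ a ω), contractOf]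
    field_simp
  · ring

/-- The factor in `payRewards` makes the rewards fractions over `payDen`, so the scale is that of
`scaled_agentUtility`. -/
theorem scaled_principalUtility (θ : Fin ℓ) (a : Fin n) (p : Fin m → ℤ) :
    ((dot (List.ofFn fun ω => scaled (commonDen (δ, I.toRaw)) (I.F θ a ω))
      (payRewards (δ, I.toRaw)) -
      dot (List.ofFn fun ω => scaled (commonDen (δ, I.toRaw)) (I.F θ a ω)) (List.ofFn p) : ℤ) : ℝ) =
    commonDen (δ, I.toRaw) * payDen (δ, I.toRaw) * I.principalUtility θ a (I.contractOf δ p) := by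
  have hE : (payDen (δ, I.toRaw) : ℝ) ≠ 0 := by exact_mod_cast (I.payDen_pos δ).ne'
  rw [payRewards_toRaw, dot_ofFn, dot_ofFn, principalUtility, mul_sub, Finset.mul_sum,
    Finset.mul_sum]
  push_cast
  congr 1
  · refine Finset.sum_congr rfl fun ω _ => ?_
    rw [cast_scaled (I.den_F_dvd δ θ a ω), cast_scaled (I.den_r_dvd δ ω), payDen]
    push_cast
    ring
  · refine Finset.sum_congr rfl fun ω _ => ?_
    rw [cast_scaled (I.den_F_dvd δ θ a ω), contractOf]
    field_simp

theorem scaled_nonneg {D : ℤ} (hD : 0 < D) {q : ℚ} (hq : 0 ≤ q) : 0 ≤ scaled D q :=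
  mul_nonneg (Rat.num_nonneg.2 hq) (Int.ediv_nonneg hD.le (by positivity))

theorem mem_payments {x : ℚ × RawInstance} {q : ℤ} : q ∈ payments x ↔
    ∃ g ∈ halves (2 * commonDen x * commonDen x), ∃ j, 0 ≤ j ∧ j ≤ resolution x ∧
      q = (alignment x - 1) * g * j * commonDen x := by
  simp only [payments, List.mem_flatMap, List.mem_map, mem_countdown]
  constructor
  · rintro ⟨g, hg, j, ⟨h1, h2⟩, rfl⟩
    exact ⟨g, hg, j - 1, by omega, by omega, rfl⟩
  · rintro ⟨g, hg, j, h1, h2, rfl⟩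
    exact ⟨g, hg, j + 1, ⟨by omega, by omega⟩, by simp⟩

theorem mem_contracts {v : List ℤ} : v ∈ contracts (δ, I.toRaw) ↔
    ∃ p : Fin m → ℤ, v = List.ofFn p ∧ ∀ ω, ∃ q ∈ payments (δ, I.toRaw),
      p ω = q + resolution (δ, I.toRaw) * scaled (commonDen (δ, I.toRaw)) (I.r ω) := by
  rw [contracts, rewards_toRaw, List.map_ofFn, List.mem_sections, List.forall₂_ofFn]
  simp only [Function.comp_apply, List.mem_map, eq_comm]

theorem nonneg_of_mem_contracts {p : Fin m → ℤ} (h : List.ofFn p ∈ contracts (δ, I.toRaw))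
    (ω : Fin m) : 0 ≤ p ω := by
  obtain ⟨p', h1, h2⟩ := (I.mem_contracts δ).1 h
  obtain rfl := List.ofFn_injective h1
  obtain ⟨q, hq, h3⟩ := h2 ω
  obtain ⟨g, hg, j, hj, -, rfl⟩ := mem_payments.1 hq
  obtain ⟨i, -, rfl⟩ := mem_halves.1 hg
  have hD := commonDen_pos (δ, I.toRaw)
  have hA := alignment_pos (δ, I.toRaw)
  have hN := resolution_pos (δ, I.toRaw)
  rw [h3]
  refine add_nonneg (mul_nonneg (mul_nonneg (mul_nonneg (by omega) ?_) hj) hD.le)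
    (mul_nonneg hN.le (scaled_nonneg hD (I.r_nonneg ω)))
  exact Int.ediv_nonneg (by positivity) (by positivity)

theorem mem_menus {M : List (List ℤ)} : M ∈ menus (δ, I.toRaw) ↔
    M.length = (resolution (δ, I.toRaw) + 1).toNat ^ m ∧ ∀ p ∈ M, p ∈ contracts (δ, I.toRaw) := by
  have h : (δ, I.toRaw).2.2.2.2.length = m := by simp [toRaw]
  rw [menus, List.map_const', List.mem_sections, List.forall₂_replicate, length_grid, h]

/-- The choices of the types from a set of contracts. -/
theorem evaluate_spec {M : List (List ℤ)} (hM : M ∈ menus (δ, I.toRaw)) :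
    ∃ (p : Fin ℓ → Fin m → ℤ) (b : Fin ℓ → Fin n), (∀ θ, List.ofFn (p θ) ∈ M) ∧
      (∀ θ q a, List.ofFn q ∈ M → I.agentUtility θ a (I.contractOf δ q) ≤
        I.agentUtility θ (b θ) (I.contractOf δ (p θ))) ∧
      (evaluate (payRewards (δ, I.toRaw)) (types (δ, I.toRaw)) M).2 =
        List.ofFn (fun θ => List.ofFn (p θ)) ∧
      ((evaluate (payRewards (δ, I.toRaw)) (types (δ, I.toRaw)) M).1 : ℝ) =
        commonDen (δ, I.toRaw) * (commonDen (δ, I.toRaw) * payDen (δ, I.toRaw)) *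
          ∑ θ, (I.μ θ : ℝ) * I.principalUtility θ (b θ) (I.contractOf δ (p θ)) := by
  obtain ⟨hlen, hmem⟩ := (I.mem_menus δ).1 hM
  have hD : (0 : ℝ) < commonDen (δ, I.toRaw) := by exact_mod_cast commonDen_pos _
  have hE : (0 : ℝ) < payDen (δ, I.toRaw) := by exact_mod_cast I.payDen_pos δ
  obtain ⟨a₀, -⟩ := I.exists_free
  have hne : M ≠ [] := by
    rintro rfl
    have := resolution_pos (δ, I.toRaw)
    have : 0 < (resolution (δ, I.toRaw) + 1).toNat ^ m := Nat.pow_pos (by omega)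
    rw [List.length_nil] at hlen
    omega
  have key : ∀ θ, ∃ (p : Fin m → ℤ) (b : Fin n), List.ofFn p ∈ M ∧
      (∀ q a, List.ofFn q ∈ M → I.agentUtility θ a (I.contractOf δ q) ≤
        I.agentUtility θ b (I.contractOf δ p)) ∧
      (response (payRewards (δ, I.toRaw)) M (List.ofFn fun a =>
        (payDen (δ, I.toRaw) * scaled (commonDen (δ, I.toRaw)) (I.c θ a),
        List.ofFn fun ω => scaled (commonDen (δ, I.toRaw)) (I.F θ a ω)))).2.2 = List.ofFn p ∧
      ((response (payRewards (δ, I.toRaw)) M (List.ofFn fun a =>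
        (payDen (δ, I.toRaw) * scaled (commonDen (δ, I.toRaw)) (I.c θ a),
        List.ofFn fun ω => scaled (commonDen (δ, I.toRaw)) (I.F θ a ω)))).2.1 : ℝ) =
        commonDen (δ, I.toRaw) * payDen (δ, I.toRaw) *
          I.principalUtility θ b (I.contractOf δ p) := by
    intro θ
    rw [response]
    generalize hL : (M.flatMap fun p => List.map _ _) = L
    have hmemL : ∀ y, y ∈ L ↔ ∃ q ∈ M, ∃ a : Fin n,
        (dot (List.ofFn fun ω => scaled (commonDen (δ, I.toRaw)) (I.F θ a ω)) q -
          payDen (δ, I.toRaw) * scaled (commonDen (δ, I.toRaw)) (I.c θ a),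
        (dot (List.ofFn fun ω => scaled (commonDen (δ, I.toRaw)) (I.F θ a ω))
          (payRewards (δ, I.toRaw)) -
        dot (List.ofFn fun ω => scaled (commonDen (δ, I.toRaw)) (I.F θ a ω)) q, q)) = y := by
      intro y
      rw [← hL]
      simp only [List.mem_flatMap, List.map_ofFn, List.mem_ofFn', Set.mem_range,
        Function.comp_apply]
    have hLne : L ≠ [] := by
      obtain ⟨q, hq⟩ := List.exists_mem_of_ne_nil M hne
      exact List.ne_nil_of_mem ((hmemL _).2 ⟨q, hq, a₀, rfl⟩)
    obtain ⟨h1, h2⟩ := argmax_spec (0, (0, [])) hLne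
    obtain ⟨q, hq, b, hb⟩ := (hmemL _).1 h1
    obtain ⟨p, rfl, -⟩ := (I.mem_contracts δ).1 (hmem q hq)
    refine ⟨p, b, hq, ?_, ?_, ?_⟩
    · intro q' a hq'
      have h3 := h2 _ ((hmemL _).2 ⟨_, hq', a, rfl⟩)
      rw [← hb] at h3
      have h4 : ((_ : ℤ) : ℝ) ≤ ((_ : ℤ) : ℝ) := Int.cast_le.2 h3
      rw [scaled_agentUtility, scaled_agentUtility] at h4
      exact le_of_mul_le_mul_left h4 (mul_pos hD hE)
    · rw [← hb]
    · rw [← hb, scaled_principalUtility]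
  choose p b h1 h2 h3 h4 using key
  refine ⟨p, b, h1, h2, ?_, ?_⟩
  · rw [evaluate, types_toRaw]
    simp only [List.map_ofFn, Function.comp_def, h3]
  · rw [evaluate, types_toRaw, List.map_ofFn, List.sum_ofFn, Finset.mul_sum]
    push_cast
    refine Finset.sum_congr rfl fun θ _ => ?_
    simp only [Function.comp_def, Int.cast_mul, h4]
    rw [cast_scaled (I.den_μ_dvd δ θ)]
    ring

/-- A rounded menu is among the sets of contracts that are tried. -/
theorem exists_mem_menus [Nonempty (Fin ℓ)] {g : Fin m → ℤ}
    (hg : ∀ ω, g ω ∈ halves (2 * commonDen (δ, I.toRaw) * commonDen (δ, I.toRaw)))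
    {j : Fin ℓ → Fin m → ℤ} (hj : ∀ θ ω, 0 ≤ j θ ω ∧ j θ ω ≤ resolution (δ, I.toRaw)) :
    ∃ M ∈ menus (δ, I.toRaw), ∀ v, v ∈ M ↔ ∃ θ, v = List.ofFn fun ω =>
      (alignment (δ, I.toRaw) - 1) * g ω * j θ ω * commonDen (δ, I.toRaw) +
        resolution (δ, I.toRaw) * scaled (commonDen (δ, I.toRaw)) (I.r ω) := by
  classical
  set N := resolution (δ, I.toRaw) with hN
  have hN0 : 0 < N := resolution_pos _
  let con : (Fin m → Fin (N + 1).toNat) → List ℤ := fun J => List.ofFn fun ω =>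
    (alignment (δ, I.toRaw) - 1) * g ω * ((J ω : ℕ) : ℤ) * commonDen (δ, I.toRaw) +
      N * scaled (commonDen (δ, I.toRaw)) (I.r ω)
  have hcon : ∀ J, con J ∈ contracts (δ, I.toRaw) := fun J =>
    (I.mem_contracts δ).2 ⟨_, rfl, fun ω => ⟨_, mem_payments.2 ⟨g ω, hg ω, _, by positivity, by
      have := (J ω).2
      omega, rfl⟩, rfl⟩⟩
  let J : Fin ℓ → Fin m → Fin (N + 1).toNat := fun θ ω =>
    ⟨(j θ ω).toNat, by have := hj θ ω; omega⟩
  have hJ : ∀ θ, con (J θ) = List.ofFn fun ω =>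
      (alignment (δ, I.toRaw) - 1) * g ω * j θ ω * commonDen (δ, I.toRaw) +
        N * scaled (commonDen (δ, I.toRaw)) (I.r ω) := by
    intro θ
    simp only [con, J]
    congr 1
    funext ω
    rw [Int.toNat_of_nonneg (hj θ ω).1]
  obtain ⟨θ₀⟩ := ‹Nonempty (Fin ℓ)›
  let e : (Fin m → Fin (N + 1).toNat) ≃ Fin ((N + 1).toNat ^ m) :=
    Fintype.equivFinOfCardEq (by simp)
  -- Candidate menus have exactly `(N + 1) ^ m` entries, one for each grid point. Grid points used
  -- by no type are filled with the contract of `θ₀`, so no new contract enters.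
  let M : List (List ℤ) := List.ofFn fun i =>
    if ∃ θ, J θ = e.symm i then con (e.symm i) else con (J θ₀)
  refine ⟨M, (I.mem_menus δ).2 ⟨by simp [M, hN], fun p hp => ?_⟩, fun v => ?_⟩
  · obtain ⟨i, rfl⟩ := (List.mem_ofFn' _ _).1 hp
    dsimp only
    split_ifs <;> exact hcon _
  · simp only [← hJ]
    constructor
    · intro hv
      obtain ⟨i, rfl⟩ := (List.mem_ofFn' _ _).1 hv
      dsimp only
      split_ifs with h
      · obtain ⟨θ, h⟩ := h
        exact ⟨θ, by rw [h]⟩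
      · exact ⟨θ₀, rfl⟩
    · rintro ⟨θ, rfl⟩
      refine (List.mem_ofFn' _ _).2 ⟨e (J θ), ?_⟩
      simp

/-- `D * q` is a positive integer. This supplies the lower bounds on `μ` and `F` required by the
rounding. -/
theorem one_le_cast_mul_of_dvd {D : ℤ} (hD : 0 < D) {q : ℚ} (hq : 0 < q) (h : (q.den : ℤ) ∣ D) :
    1 ≤ (D : ℝ) * q := by
  rw [← cast_scaled h]
  have h1 : 0 < scaled D q :=
    mul_pos (Rat.num_pos.2 hq) (Int.ediv_pos_of_pos_of_dvd hD (by positivity) h)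
  exact_mod_cast h1

/-- The output of the algorithm is a DSIC menu that is optimal up to `δ`. -/
theorem solve_spec (hδ : 0 < δ) : ∃ p : Fin ℓ → Fin m → ℤ,
    solve (δ, I.toRaw) =
      List.ofFn (fun θ => List.ofFn fun ω => (p θ ω, payDen (δ, I.toRaw))) ∧
    I.IsDSIC (fun θ => I.contractOf δ (p θ)) ∧ ∀ P, I.IsDSIC P →
      I.menuUtility P - (δ : ℝ) ≤ I.menuUtility fun θ => I.contractOf δ (p θ) := by
  have hD := commonDen_pos (δ, I.toRaw)
  have hN := resolution_pos (δ, I.toRaw)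
  have hA := alignment_pos (δ, I.toRaw)
  have hE := I.payDen_pos δ
  have hDr : (0 : ℝ) < commonDen (δ, I.toRaw) := by exact_mod_cast hD
  have hEr : (0 : ℝ) < payDen (δ, I.toRaw) := by exact_mod_cast hE
  have hNr : (0 : ℝ) < resolution (δ, I.toRaw) := by exact_mod_cast hN
  have hAr : (0 : ℝ) < alignment (δ, I.toRaw) := by exact_mod_cast zero_lt_two.trans_le hA
  have hne : Nonempty (Fin ℓ) := by
    by_contra h
    rw [not_nonempty_iff] at h
    simpa using I.μ_sum
  have near : ∀ P, I.IsDSIC P → 0 ≤ I.menuUtility P → ∃ M ∈ menus (δ, I.toRaw),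
      commonDen (δ, I.toRaw) * (commonDen (δ, I.toRaw) * payDen (δ, I.toRaw)) *
        (I.menuUtility P - (δ : ℝ)) ≤
      ((evaluate (payRewards (δ, I.toRaw)) (types (δ, I.toRaw)) M).1 : ℝ) := by
    intro P hP h0
    obtain ⟨g, hg, j, hj, s, hs, hbound⟩ := hP.exists_rounding h0 (D := commonDen (δ, I.toRaw))
      (N := resolution (δ, I.toRaw)) (A := alignment (δ, I.toRaw)) hD hN (by omega)
      (fun θ h => one_le_cast_mul_of_dvd hD h (I.den_μ_dvd δ θ))
      (fun θ a ω h => one_le_cast_mul_of_dvd hD h (I.den_F_dvd δ θ a ω))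
    obtain ⟨M, hM, hMmem⟩ := I.exists_mem_menus δ hg hj
    obtain ⟨p, b, h1, h2, -, h4⟩ := I.evaluate_spec δ hM
    refine ⟨M, hM, ?_⟩
    rw [h4]
    refine mul_le_mul_of_nonneg_left ?_ (by positivity)
    have hcon : ∀ θ, I.contractOf δ (fun ω =>
        (alignment (δ, I.toRaw) - 1) * g ω * j θ ω * commonDen (δ, I.toRaw) +
          resolution (δ, I.toRaw) * scaled (commonDen (δ, I.toRaw)) (I.r ω)) = s θ := by
      intro θ
      funext ω
      rw [hs, contractOf, payDen]
      push_cast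
      rw [cast_scaled (I.den_r_dvd δ ω)]
      field_simp
    have h5 := hbound (fun θ => I.contractOf δ (p θ)) b
      (fun θ => by
        obtain ⟨θ', h⟩ := (hMmem _).1 (h1 θ)
        exact ⟨θ', by rw [← hcon, List.ofFn_injective h]⟩)
      (fun θ θ' a => by
        rw [← hcon]
        exact h2 θ _ a ((hMmem _).2 ⟨θ', rfl⟩))
    refine le_trans ?_ h5
    -- With `N = A² * (1 + 4 * m)` both terms equal `1 / A`, and `A` is twice the denominator of
    -- `δ`.
    have h6 : 1 / (alignment (δ, I.toRaw) : ℝ) + alignment (δ, I.toRaw) * (4 * m + 1) /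
        resolution (δ, I.toRaw) = 1 / (δ.den : ℝ) := by
      have hm : outcomes (δ, I.toRaw) = m := by rw [outcomes_eq]; simp [toRaw]
      have hden : (0 : ℝ) < δ.den := by exact_mod_cast δ.den_pos
      have hm0 : (0 : ℝ) < 1 + 4 * m := by positivity
      rw [resolution, hm, alignment]
      push_cast
      field_simp
      ring
    have h7 : 1 / (δ.den : ℝ) ≤ δ := by
      have hnum : (1 : ℝ) ≤ δ.num := by exact_mod_cast Rat.num_pos.2 hδ
      rw [Rat.cast_def δ]
      gcongr
    rw [h6]
    linarith
  -- Rounding the zero menu shows that the list of candidates is not empty.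
  obtain ⟨M₀, hM₀, -⟩ := near _ I.zero_isDSIC I.menuUtility_zero_nonneg
  obtain ⟨hmax1, hmax2⟩ := argmax_spec (0, [])
    (List.ne_nil_of_mem (List.mem_map_of_mem
      (f := fun M => evaluate (payRewards (δ, I.toRaw)) (types (δ, I.toRaw)) M) hM₀))
  obtain ⟨M, hM, hMeq⟩ := List.mem_map.1 hmax1
  obtain ⟨p, b, h1, h2, h3, h4⟩ := I.evaluate_spec δ hM
  have hpref : ∀ θ θ' a, I.agentUtility θ a (I.contractOf δ (p θ')) ≤
      I.agentUtility θ (b θ) (I.contractOf δ (p θ)) := fun θ θ' a => h2 θ _ a (h1 θ')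
  have hvalue : ∑ θ, (I.μ θ : ℝ) * I.principalUtility θ (b θ) (I.contractOf δ (p θ)) ≤
      I.menuUtility fun θ => I.contractOf δ (p θ) :=
    Finset.sum_le_sum fun θ _ => mul_le_mul_of_nonneg_left
      (I.principalUtility_le_bestResponse fun a => hpref θ θ a) (by exact_mod_cast I.μ_nonneg θ)
  have hopt : ∀ P, I.IsDSIC P → 0 ≤ I.menuUtility P →
      I.menuUtility P - (δ : ℝ) ≤ I.menuUtility fun θ => I.contractOf δ (p θ) := by
    intro P hP h0
    obtain ⟨M', hM', h5⟩ := near P hP h0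
    have h6 := hmax2 _ (List.mem_map_of_mem hM')
    rw [← hMeq] at h6
    have h7 := h5.trans (Int.cast_le.2 h6)
    rw [h4] at h7
    exact (le_of_mul_le_mul_left h7 (by positivity)).trans hvalue
  refine ⟨p, ?_, ⟨fun θ ω => ?_, fun θ θ' _ => ?_⟩, fun P hP => ?_⟩
  · rw [solve, ← hMeq, h3, List.map_ofFn]
    simp only [Function.comp_def, List.map_ofFn]
  · have := I.nonneg_of_mem_contracts δ (((I.mem_menus δ).1 hM).2 _ (h1 θ)) ω
    exact div_nonneg (by exact_mod_cast this) hEr.le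
  · exact (hpref θ θ' _).trans (I.agentUtility_le_bestResponse θ _ _)
  · rcases le_total 0 (I.menuUtility P) with h | h
    · exact hopt P hP h
    · have := hopt _ I.zero_isDSIC I.menuUtility_zero_nonneg
      have := I.menuUtility_zero_nonneg
      linarith

end PAInstance

theorem mainTheorem3 : ∃ A : Program, ∀ m : ℕ, IsAdditivePTAS m A := by
  obtain ⟨A, hA⟩ := PolyOn.solve
  refine ⟨A, fun m δ hδ => ?_⟩
  obtain ⟨q, hq⟩ := hA (m, δ)
  -- The input also contains `δ`; for fixed `δ` it adds the constant `sz δ + 1` to the size of the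
  -- instance.
  refine ⟨q.comp (Polynomial.X + Polynomial.C (sz δ + 1)), fun ℓ n I => ?_⟩
  obtain ⟨t, ht, hr⟩ := hq (δ, I.toRaw) ⟨rfl, by simp [PAInstance.toRaw]⟩
  obtain ⟨p, h1, h2, h3⟩ := I.solve_spec δ hδ
  refine ⟨_, t, fun θ => I.contractOf δ (p θ), ?_, ?_,
    ⟨p, fun _ _ => RawInstance.payDen (δ, I.toRaw), fun θ ω => ⟨I.payDen_pos δ, rfl⟩, rfl⟩, h2, h3⟩
  · rw [h1, Enc.enc_ofFn] at hr
    simp only [Enc.enc_ofFn] at hr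
    rw [← I.enc_toRaw]
    exact hr
  · refine ht.trans (le_of_eq ?_)
    rw [sz_pair, Polynomial.eval_comp, ← I.enc_toRaw]
    simp only [Polynomial.eval_add, Polynomial.eval_X, Polynomial.eval_C]
    congr 1
    simp only [sz]
    ring
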